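/- Let $q\in\mathbb R$ with $|q|<1$, and let $\mathcal H=\ell^2(\mathbb Z)$ with canonical orthonormal basis $(e_i)_{i\in\mathbb Z}$. Let $\mathcal F_q$ be the $q$-deformed Fock space, i.e. the completion of the algebraic linear span of a vacuum vector $\Omega$ and of the vectors $f_1\otimes\cdots\otimes f_n$ ($n\ge 1$, $f_j\in\mathcal H$) with respect to the inner product (where $\|\Omega\|=1$ and $\Omega$ is orthogonal to all $f_1\otimes\cdots\otimes f_n$, $n\ge1$) $$\langle f_1\otimes\cdots\otimes f_n,\,g_1\otimes\cdots\otimes g_m\rangle_q=\delta_{n,m}\sum_{\pi\in S_n}q^{i(\pi)}\langle f_1,g_{\pi(1)}\rangle\cdots\langle f_n,g_{\pi(n)}\rangle ,$$ $i(\pi)$ being the number of inversions of $\pi$. Let $a_i^+$ be the bounded creation operator on $\mathcal F_q$ determined by $a_i^+\Omega=e_i$ and $a_i^+(f_1\otimes\cdots\otimes f_n)=e_i\otimes f_1\otimes\cdots\otimes f_n$, and let $a_i$ be its adjoint. Let $\mathcal R_q$ and $\mathcal G_q$ be the unital $C^*$-algebras of operators on $\mathcal F_q$ generated by $\{a_i\mid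 i\in\mathbb Z\}$ and by $\{a_i+a_i^+\mid i\in\mathbb Z\}$, respectively. Let $\alpha$ be the right shift, i.e. the $*$-automorphism of $\mathcal R_q$ determined by $\alpha(a_i)=a_{i+1}$ for all $i\in\mathbb Z$; it restricts to a $*$-automorphism $\alpha\lceil_{\mathcal G_q}$ of $\mathcal G_q$. Let $\omega(x)=\langle x\Omega,\Omega\rangle_q$ for $x\in\mathcal G_q$. Then $(\mathcal G_q,\alpha\lceil_{\mathcal G_q})$ is uniquely mixing, i.e. there is a state $\omega_0$ of $\mathcal G_q$ such that $$\lim_{n\to+\infty}\varphi(\alpha^n(x))=\varphi(1)\,\omega_0(x)\qquad\text{for all }x\in\mathcal G_q\text{ and all bounded linear functionals }\varphi\text{ on }\mathcal G_q .$$ Moreover, $\omega$ is a state of $\mathcal G_q$, and it is the unique state of $\mathcal G_q$ that is invariant under $\alpha\lceil_{\mathcal G_q}$. Finally, $\omega$ is a trace, $\omega(xy)=\omega(yx)$ for all $x,y\in\mathcal G_q$, and it is faithful on $\mathcal G_q$: if $\omega(x^*x)=0$ then $x=0$. -/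

import Mathlib

open scoped ComplexOrder ComplexConjugate Matrix

namespace QGaussian
section form
/-- The number of inversions of a permutation. -/
def inversions {n : ℕ} (π : Equiv.Perm (Fin n)) : ℕ :=
  (Finset.univ.filter fun p : Fin n × Fin n => p.1 < p.2 ∧ π p.2 < π p.1).card

variable {H : Type} [NormedAddCommGroup H] [InnerProductSpace ℂ H]

/-- The `q`-inner product of two elementary tensors of degree `n`:
`⟨f₁ ⊗ ⋯ ⊗ fₙ, g₁ ⊗ ⋯ ⊗ gₙ⟩ = ∑_π q ^ i(π) ∏ₖ ⟨fₖ, g_π(k)⟩`. As everywhere in Mathlib, inner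
products are linear in the second variable. -/
noncomputable def tensorForm (q : ℝ) (n : ℕ) (f g : Fin n → H) : ℂ :=
  ∑ π : Equiv.Perm (Fin n), (q : ℂ) ^ inversions π * ∏ k, inner ℂ (f k) (g (π k))

theorem inversions_inv {n : ℕ} (π : Equiv.Perm (Fin n)) : inversions π⁻¹ = inversions π := by
  unfold inversions
  refine Finset.card_nbij' (fun p => (π⁻¹ p.2, π⁻¹ p.1)) (fun p => (π p.2, π p.1)) ?_ ?_ ?_ ?_ <;>
    simp +contextual [Set.MapsTo, Set.LeftInvOn]

theorem conj_tensorForm (q : ℝ) (n : ℕ) (f g : Fin n → H) :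
    conj (tensorForm q n f g) = tensorForm q n g f := by
  unfold tensorForm
  rw [map_sum, ← Equiv.sum_comp (Equiv.inv (Equiv.Perm (Fin n)))]
  refine Finset.sum_congr rfl fun π _ => ?_
  simp only [Equiv.inv_apply, inversions_inv, map_mul, map_pow, Complex.conj_ofReal, map_prod,
    inner_conj_symm]
  congr 1
  rw [← Equiv.prod_comp π]
  simp

theorem inversions_mul_inv {n : ℕ} (σ τ : Equiv.Perm (Fin n)) :
    inversions (τ * σ⁻¹) = (Finset.univ.filter fun p : Fin n × Fin n =>
      p.1 < p.2 ∧ ¬ (σ p.1 < σ p.2 ↔ τ p.1 < τ p.2)).card := by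
  have e : ∀ a, σ⁻¹ (σ a) = a := fun a => by simp
  have e' : ∀ a, σ (σ⁻¹ a) = a := fun a => by simp
  unfold inversions
  symm
  refine Finset.card_nbij'
    (fun p => if σ p.1 < σ p.2 then (σ p.1, σ p.2) else (σ p.2, σ p.1))
    (fun p => if σ⁻¹ p.1 < σ⁻¹ p.2 then (σ⁻¹ p.1, σ⁻¹ p.2) else (σ⁻¹ p.2, σ⁻¹ p.1)) ?_ ?_ ?_ ?_
  · rintro ⟨a, b⟩ h
    replace h := (Finset.mem_filter.1 h).2
    refine Finset.mem_coe.2 (Finset.mem_filter.2 ⟨Finset.mem_univ _, ?_⟩)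
    have h2 : σ a ≠ σ b := fun h' => h.1.ne (σ.injective h')
    have h3 : τ a ≠ τ b := fun h' => h.1.ne (τ.injective h')
    by_cases hs : σ a < σ b <;> simp only [hs, if_true, if_false, Equiv.Perm.mul_apply, e] at h ⊢ <;>
      grind
  · rintro ⟨a, b⟩ h
    replace h := (Finset.mem_filter.1 h).2
    refine Finset.mem_coe.2 (Finset.mem_filter.2 ⟨Finset.mem_univ _, ?_⟩)
    have h2 : σ⁻¹ a ≠ σ⁻¹ b := fun h' => h.1.ne (σ⁻¹.injective h')
    by_cases hs : σ⁻¹ a < σ⁻¹ b <;>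
      simp only [hs, if_true, if_false, Equiv.Perm.mul_apply, e'] at h ⊢ <;> grind
  · rintro ⟨a, b⟩ h
    replace h := (Finset.mem_filter.1 h).2
    by_cases hs : σ a < σ b <;> simp only [hs, if_true, if_false, e] at h ⊢ <;> grind
  · rintro ⟨a, b⟩ h
    replace h := (Finset.mem_filter.1 h).2
    by_cases hs : σ⁻¹ a < σ⁻¹ b <;> simp only [hs, if_true, if_false, e'] at h ⊢ <;> grind

theorem posSemidef_prod {κ ι : Type} [Finite κ] (s : Finset ι) (K : ι → Matrix κ κ ℂ)
    (hK : ∀ i ∈ s, (K i).PosSemidef) :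
    (Matrix.of fun a b => ∏ i ∈ s, K i a b).PosSemidef := by
  classical
  induction s using Finset.induction_on with
  | empty =>
    have := Matrix.posSemidef_vecMulVec_self_star (fun _ : κ => (1 : ℂ))
    convert this
    ext a b
    simp [Matrix.vecMulVec]
  | insert i s hi ih =>
    have e : (Matrix.of fun a b => ∏ j ∈ insert i s, K j a b) =
        K i ⊙ (Matrix.of fun a b => ∏ j ∈ s, K j a b) := by
      ext a b
      simp [Finset.prod_insert hi]
    rw [e]
    exact (hK i (by simp)).hadamard (ih fun j hj => hK j (by simp [hj]))

theorem posSemidef_agree {κ : Type} [Finite κ] (q : ℝ) (hq : |q| ≤ 1) (P : κ → Prop)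
    [DecidablePred P] :
    (Matrix.of fun a b => if ¬ (P a ↔ P b) then (q : ℂ) else 1).PosSemidef := by
  have h1 := Matrix.posSemidef_vecMulVec_self_star (fun _ : κ => (1 : ℂ))
  have h2 := Matrix.posSemidef_vecMulVec_self_star (fun a : κ => if P a then (1 : ℂ) else -1)
  have hq' := abs_le.1 hq
  have h3 := (h1.smul (a := (1 + q) / 2) (by linarith)).add
    (h2.smul (a := (1 - q) / 2) (by linarith))
  convert h3 using 1
  ext a b
  by_cases ha : P a <;> by_cases hb : P b <;> simp [Matrix.vecMulVec, ha, hb] <;> ring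

theorem tensorForm_posSemidef {κ : Type} [Finite κ] (q : ℝ) (hq : |q| ≤ 1) (n : ℕ)
    (f : κ → Fin n → H) : (Matrix.of fun a b => tensorForm q n (f a) (f b)).PosSemidef := by
  classical
  cases nonempty_fintype κ
  let G : Fin n → Matrix (κ × Equiv.Perm (Fin n)) (κ × Equiv.Perm (Fin n)) ℂ :=
    fun k => Matrix.gram ℂ fun a => f a.1 (a.2 k)
  let K : Fin n × Fin n → Matrix (κ × Equiv.Perm (Fin n)) (κ × Equiv.Perm (Fin n)) ℂ :=
    fun p => Matrix.of fun a b =>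
      if ¬ (a.2 p.1 < a.2 p.2 ↔ b.2 p.1 < b.2 p.2) then (q : ℂ) else 1
  have h := (posSemidef_prod Finset.univ G fun k _ => Matrix.posSemidef_gram ℂ _).hadamard
    (posSemidef_prod (Finset.univ.filter fun p : Fin n × Fin n => p.1 < p.2) K fun p _ =>
      posSemidef_agree q hq fun a : κ × Equiv.Perm (Fin n) => a.2 p.1 < a.2 p.2)
  have key : ∀ a b : κ, ∀ σ : Equiv.Perm (Fin n),
      ∑ τ : Equiv.Perm (Fin n), ((Matrix.of fun a b => ∏ i, G i a b) ⊙
        (Matrix.of fun a b => ∏ p with p.1 < p.2, K p a b)) (a, σ) (b, τ) =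
      tensorForm q n (f a) (f b) := by
    intro a b σ
    unfold tensorForm
    rw [← Equiv.sum_comp (Equiv.mulRight σ⁻¹) fun π => (q : ℂ) ^ inversions π * _]
    refine Finset.sum_congr rfl fun τ _ => ?_
    simp only [Equiv.coe_mulRight, inversions_mul_inv, Matrix.hadamard_apply, Matrix.of_apply, K, G,
      Matrix.gram_apply]
    rw [mul_comm]
    congr 1
    · rw [Finset.prod_ite]
      simp [Finset.filter_filter]
    · rw [← Equiv.prod_comp σ fun k => inner ℂ (f a k) (f b ((τ * σ⁻¹) k))]
      simp
  refine Matrix.PosSemidef.of_dotProduct_mulVec_nonneg ?_ ?_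
  · ext a b
    simpa using conj_tensorForm q n (f b) (f a)
  · intro x
    have h0 := h.dotProduct_mulVec_nonneg fun a => x a.1
    have : star (fun a : κ × Equiv.Perm (Fin n) => x a.1) ⬝ᵥ (((Matrix.of fun a b => ∏ i, G i a b) ⊙
        (Matrix.of fun a b => ∏ p with p.1 < p.2, K p a b)) *ᵥ fun a => x a.1) =
        (Fintype.card (Equiv.Perm (Fin n)) : ℂ) *
          (star x ⬝ᵥ (Matrix.of fun a b => tensorForm q n (f a) (f b)) *ᵥ x) := by
      simp only [dotProduct, Matrix.mulVec, Fintype.sum_prod_type, ← Finset.sum_mul, key]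
      simp [Finset.mul_sum, mul_assoc]
    rw [this] at h0
    have h1 : (0 : ℂ) ≤ ((Fintype.card (Equiv.Perm (Fin n)) : ℝ)⁻¹ : ℝ) :=
      Complex.zero_le_real.2 (by positivity)
    have h2 := mul_nonneg h1 h0
    have h3 : (Fintype.card (Equiv.Perm (Fin n)) : ℂ) ≠ 0 :=
      Nat.cast_ne_zero.2 Fintype.card_ne_zero
    rwa [Complex.ofReal_inv, Complex.ofReal_natCast, inv_mul_cancel_left₀ h3] at h2

/-- Expansion of the `q`-inner product along the first tensor factor. -/
theorem tensorForm_cons (q : ℝ) (n : ℕ) (f : H) (u : Fin n → H) (v : Fin (n + 1) → H) :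
    tensorForm q (n + 1) (Fin.cons f u) v =
      ∑ k : Fin (n + 1), (q : ℂ) ^ (k : ℕ) * inner ℂ f (v k) *
        tensorForm q n u (v ∘ k.succAbove) := by
  let E : Fin (n + 1) × Equiv.Perm (Fin n) → Equiv.Perm (Fin (n + 1)) := fun p =>
    p.1.cycleRange⁻¹ * Equiv.Perm.decomposeFin.symm (0, p.2)
  have E0 : ∀ p, E p 0 = p.1 := fun p => by simp [E, Equiv.Perm.inv_def]
  have Es : ∀ p i, E p (Fin.succ i) = p.1.succAbove (p.2 i) := fun p i => by
    simp [E, Equiv.Perm.inv_def]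
  have hE : Function.Bijective E := by
    refine (Fintype.bijective_iff_injective_and_card E).2 ⟨?_, ?_⟩
    · intro p p' h
      have h1 : p.1 = p'.1 := by rw [← E0, h, E0]
      refine Prod.ext h1 (Equiv.ext fun i => ?_)
      have h2 := Es p i
      rw [h, Es, h1] at h2
      exact (Fin.succAbove_right_injective h2).symm
    · simp [Fintype.card_perm, Nat.factorial_succ]
  have hinv : ∀ {m : ℕ} (π : Equiv.Perm (Fin m)),
      inversions π = ∑ i, ∑ j, if i < j ∧ π j < π i then 1 else 0 := fun π => by
    rw [inversions, Finset.card_filter, Fintype.sum_prod_type]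
  have hi : ∀ p, inversions (E p) = p.1 + inversions p.2 := by
    intro p
    rw [hinv, hinv, Fin.sum_univ_succ]
    congr 1
    · rw [Fin.sum_univ_succ]
      simp only [lt_self_iff_false, false_and, if_false, zero_add, Fin.succ_pos, true_and, E0, Es]
      rw [Equiv.sum_comp p.2 fun j => if p.1.succAbove j < p.1 then 1 else 0]
      have : ∀ j : Fin n, p.1.succAbove j < p.1 ↔ (j : ℕ) < (p.1 : ℕ) := fun j => by
        rw [Fin.succAbove_lt_iff_castSucc_lt, Fin.lt_def, Fin.val_castSucc]
      simp only [this]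
      rw [Fin.sum_univ_eq_sum_range fun j => if j < (p.1 : ℕ) then 1 else 0, ← Finset.card_filter]
      have : Finset.filter (fun j => j < (p.1 : ℕ)) (Finset.range n) = Finset.range p.1 := by
        ext j
        simp only [Finset.mem_filter, Finset.mem_range]
        have := p.1.isLt
        omega
      rw [this, Finset.card_range]
    · refine Finset.sum_congr rfl fun i _ => ?_
      rw [Fin.sum_univ_succ]
      simp [Es]
  unfold tensorForm
  rw [← hE.sum_comp, Fintype.sum_prod_type]
  refine Finset.sum_congr rfl fun k _ => ?_
  rw [Finset.mul_sum]
  refine Finset.sum_congr rfl fun ρ _ => ?_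
  rw [hi, Fin.prod_univ_succ]
  simp only [E0, Es, Fin.cons_zero, Fin.cons_succ, Function.comp]
  ring

/-- The `q`-inner product of two words; words of different lengths are orthogonal. -/
noncomputable def wordForm (q : ℝ) (u v : List H) : ℂ :=
  if h : u.length = v.length then tensorForm q u.length u.get fun k => v.get (Fin.cast h k) else 0

theorem wordForm_of_length_ne (q : ℝ) {u v : List H} (h : u.length ≠ v.length) :
    wordForm q u v = 0 := dif_neg h

theorem wordForm_eq (q : ℝ) {n : ℕ} {u v : List H} (hu : u.length = n) (hv : v.length = n) :
    wordForm q u v =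
      tensorForm q n (fun k => u.get (Fin.cast hu.symm k)) fun k => v.get (Fin.cast hv.symm k) := by
  subst hu
  rw [wordForm, dif_pos hv.symm]
  rfl

theorem conj_wordForm (q : ℝ) (u v : List H) : conj (wordForm q u v) = wordForm q v u := by
  by_cases h : u.length = v.length
  · rw [wordForm_eq q h rfl, wordForm_eq q rfl h, conj_tensorForm]
  · rw [wordForm_of_length_ne q h, wordForm_of_length_ne q (Ne.symm h), map_zero]

theorem wordForm_cons (q : ℝ) (f : H) (u v : List H) :
    wordForm q (f :: u) v =
      ∑ k : Fin v.length, (q : ℂ) ^ (k : ℕ) * inner ℂ f (v.get k) * wordForm q u (v.eraseIdx k) := by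
  by_cases h : v.length = u.length + 1
  · rw [wordForm_eq q (n := u.length + 1) rfl h]
    have h1 : (fun k => (f :: u).get (Fin.cast rfl k)) = Fin.cons f u.get := by
      ext k
      refine Fin.cases rfl (fun i => rfl) k
    refine (congrArg (fun w => tensorForm q (u.length + 1) w _) h1).trans ?_
    rw [tensorForm_cons]
    refine Fintype.sum_equiv (finCongr h.symm) _ _ fun k => ?_
    congr 1
    have h2 : (v.eraseIdx k).length = u.length := by
      rw [List.length_eraseIdx_of_lt (by omega), h]; rfl
    simp only [finCongr_apply, Fin.val_cast]
    rw [wordForm_eq q rfl h2]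
    congr 1
    ext i
    simp only [Function.comp, List.get_eq_getElem, Fin.val_cast, List.getElem_eraseIdx]
    rcases lt_or_ge (i : ℕ) (k : ℕ) with hik | hik
    · rw [dif_pos hik]
      congr 1
      rw [Fin.succAbove_of_castSucc_lt _ _ (by simpa [Fin.lt_def] using hik), Fin.val_castSucc]
    · rw [dif_neg (by omega)]
      congr 1
      rw [Fin.succAbove_of_le_castSucc _ _ (by simpa [Fin.le_def] using hik), Fin.val_succ]
  · rw [wordForm_of_length_ne q (by simpa using Ne.symm h)]
    refine (Finset.sum_eq_zero fun k _ => ?_).symm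
    rw [wordForm_of_length_ne q, mul_zero]
    rw [List.length_eraseIdx_of_lt k.isLt]
    have := k.isLt
    omega

theorem wordForm_map (q : ℝ) (S : H →ₗᵢ[ℂ] H) (u v : List H) :
    wordForm q (u.map S) (v.map S) = wordForm q u v := by
  by_cases h : u.length = v.length
  · rw [wordForm_eq q (n := v.length) (by simpa) (by simp), wordForm_eq q h rfl]
    simp [tensorForm]
  · rw [wordForm_of_length_ne q h, wordForm_of_length_ne q (by simpa using h)]

/-- Sesquilinear extension of `wordForm` to formal linear combinations of words. -/
noncomputable def finForm (q : ℝ) (x y : List H →₀ ℂ) : ℂ :=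
  x.sum fun u a => y.sum fun v b => conj a * b * wordForm q u v

theorem finForm_self_nonneg (q : ℝ) (hq : |q| ≤ 1) (x : List H →₀ ℂ) : 0 ≤ finForm q x x := by
  classical
  let s : Finset (List H) := x.support
  let c : List H → ℂ := fun u => x u
  have h0 : finForm q x x = ∑ u ∈ s, ∑ v ∈ s, conj (c u) * c v * wordForm q u v := rfl
  have h1 : ∀ u ∈ s, ∑ v ∈ s, conj (c u) * c v * wordForm q u v =
      ∑ v ∈ s with v.length = u.length, conj (c u) * c v * wordForm q u v := by
    intro u _
    rw [Finset.sum_filter]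
    refine Finset.sum_congr rfl fun v _ => ?_
    split_ifs with h
    · rfl
    · rw [wordForm_of_length_ne q (Ne.symm h), mul_zero]
  rw [h0, Finset.sum_congr rfl h1,
    ← Finset.sum_fiberwise_of_maps_to (g := List.length) (t := s.image List.length)
      fun u hu => Finset.mem_image_of_mem _ hu]
  refine Finset.sum_nonneg fun n _ => ?_
  have hl : ∀ a : {u : List H // u ∈ s.filter fun u : List H => u.length = n}, a.1.length = n := fun a => (Finset.mem_filter.1 a.2).2
  have h2 := (tensorForm_posSemidef q hq n
    fun (a : {u : List H // u ∈ s.filter fun u : List H => u.length = n}) k => a.1.get (Fin.cast (hl a).symm k)).dotProduct_mulVec_nonneg fun a => c a.1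
  have h3 : ∑ u ∈ s with u.length = n, ∑ v ∈ s with v.length = u.length,
      conj (c u) * c v * wordForm q u v = ∑ a : {u : List H // u ∈ s.filter fun u : List H => u.length = n},
        ∑ b : {u : List H // u ∈ s.filter fun u : List H => u.length = n},
          conj (c a.1) * c b.1 * wordForm q a.1 b.1 := by
    rw [← Finset.sum_coe_sort (s.filter fun u : List H => u.length = n)]
    refine Finset.sum_congr rfl fun a _ => ?_
    rw [hl a, ← Finset.sum_coe_sort (s.filter fun u : List H => u.length = n)]
  rw [h3]
  convert h2 using 1
  simp only [dotProduct, Matrix.mulVec, Matrix.of_apply, Finset.mul_sum]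
  refine Finset.sum_congr rfl fun a _ => Finset.sum_congr rfl fun b _ => ?_
  rw [wordForm_eq q (hl a) (hl b)]
  simp only [Pi.star_apply, RCLike.star_def]
  ring

theorem conj_finForm (q : ℝ) (x y : List H →₀ ℂ) : conj (finForm q y x) = finForm q x y := by
  simp only [finForm, Finsupp.sum, map_sum, map_mul, conj_wordForm, Complex.conj_conj]
  rw [Finset.sum_comm]
  refine Finset.sum_congr rfl fun u _ => Finset.sum_congr rfl fun v _ => ?_
  ring

theorem finForm_add_left (q : ℝ) (x y z : List H →₀ ℂ) :
    finForm q (x + y) z = finForm q x z + finForm q y z := by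
  refine Finsupp.sum_add_index' (by simp) fun u a b => ?_
  rw [← Finsupp.sum_add]
  simp [add_mul]

theorem finForm_smul_left (q : ℝ) (x y : List H →₀ ℂ) (r : ℂ) :
    finForm q (r • x) y = conj r * finForm q x y := by
  refine (Finsupp.sum_smul_index (by simp)).trans ?_
  simp [finForm, Finsupp.mul_sum, mul_assoc]

end form

/-! ### The algebraic Fock space -/

/-- The algebraic linear span of the words `f₁ ⊗ ⋯ ⊗ fₙ` (`n = 0` gives the vacuum vector), as
formal linear combinations of finite lists of vectors of `H`.  It carries the `q`-inner product
`finForm`; the multilinearity relations between words hold up to vectors of norm zero, which are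
identified in the Hausdorff completion `Fock`. -/
def PreFock (_q : ℝ) (H : Type) : Type := List H →₀ ℂ

namespace PreFock

section algebra

variable {q : ℝ} {H : Type}

noncomputable instance : AddCommGroup (PreFock q H) := inferInstanceAs (AddCommGroup (List H →₀ ℂ))
noncomputable instance : Module ℂ (PreFock q H) := inferInstanceAs (Module ℂ (List H →₀ ℂ))

/-- The word `f₁ ⊗ ⋯ ⊗ fₙ`. -/
noncomputable def word (q : ℝ) (u : List H) : PreFock q H := Finsupp.single u 1

theorem induction {p : PreFock q H → Prop} (x : PreFock q H) (h0 : p 0)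
    (hadd : ∀ x y, p x → p y → p (x + y)) (hword : ∀ (c : ℂ) u, p (c • word q u)) : p x := by
  refine Finsupp.induction_linear x h0 hadd fun u c => ?_
  have := hword c u
  rwa [show c • word q u = Finsupp.single u c from by
    refine (Finsupp.smul_single _ _ _).trans ?_
    simp] at this

/-- Left creation on words: `f₁ ⊗ ⋯ ⊗ fₙ ↦ f ⊗ f₁ ⊗ ⋯ ⊗ fₙ`. -/
noncomputable def creator (f : H) : PreFock q H →ₗ[ℂ] PreFock q H :=
  Finsupp.lmapDomain ℂ ℂ (List.cons f)

/-- `f₁ ⊗ ⋯ ⊗ fₙ ↦ S f₁ ⊗ ⋯ ⊗ S fₙ`. -/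
noncomputable def gamma (S : H → H) : PreFock q H →ₗ[ℂ] PreFock q H :=
  Finsupp.lmapDomain ℂ ℂ (List.map S)

theorem creator_word (f : H) (u : List H) : creator f (word q u) = word q (f :: u) :=
  Finsupp.mapDomain_single

theorem gamma_word (S : H → H) (u : List H) : gamma S (word q u) = word q (u.map S) :=
  Finsupp.mapDomain_single

theorem exists_mem_span (x : PreFock q H) :
    ∃ n, x ∈ Submodule.span ℂ (word q '' {u : List H | u.length < n}) := by
  induction x using PreFock.induction with
  | h0 => exact ⟨0, Submodule.zero_mem _⟩
  | hadd x y hx hy =>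
    obtain ⟨n, hn⟩ := hx
    obtain ⟨m, hm⟩ := hy
    have mono : ∀ {k l : ℕ}, k ≤ l → Submodule.span ℂ (word q '' {u : List H | u.length < k}) ≤
        Submodule.span ℂ (word q '' {u : List H | u.length < l}) := fun h =>
      Submodule.span_mono (Set.image_mono fun u hu => lt_of_lt_of_le hu h)
    exact ⟨max n m, Submodule.add_mem _ (mono (le_max_left _ _) hn) (mono (le_max_right _ _) hm)⟩
  | hword c u =>
    exact ⟨u.length + 1, Submodule.smul_mem _ _ (Submodule.subset_span ⟨u, Nat.lt_succ_self _, rfl⟩)⟩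

variable [NormedAddCommGroup H] [InnerProductSpace ℂ H]

/-- Annihilation on words: `f₁ ⊗ ⋯ ⊗ fₙ ↦ ∑ₖ q ^ (k-1) ⟨f, fₖ⟩ f₁ ⊗ ⋯ f̂ₖ ⋯ ⊗ fₙ`
(the index `k` starts from `0` here). -/
noncomputable def annihilator (f : H) : PreFock q H →ₗ[ℂ] PreFock q H :=
  Finsupp.linearCombination ℂ fun v : List H =>
    ∑ k : Fin v.length, ((q : ℂ) ^ (k : ℕ) * inner ℂ f (v.get k)) • word q (v.eraseIdx k)

theorem annihilator_word (f : H) (v : List H) : annihilator f (word q v) =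
    ∑ k : Fin v.length, ((q : ℂ) ^ (k : ℕ) * inner ℂ f (v.get k)) • word q (v.eraseIdx k) :=
  (Finsupp.linearCombination_single _ _ _).trans (one_smul _ _)

theorem annihilator_mem (f : H) (n : ℕ) (x : PreFock q H)
    (hx : x ∈ Submodule.span ℂ (word q '' {u : List H | u.length < n + 1})) :
    annihilator f x ∈ Submodule.span ℂ (word q '' {u : List H | u.length < n}) := by
  induction hx using Submodule.span_induction with
  | mem x hx =>
    obtain ⟨v, hv, rfl⟩ := hx
    rw [annihilator_word]
    refine Submodule.sum_mem _ fun k _ => Submodule.smul_mem _ _ (Submodule.subset_span ⟨_, ?_, rfl⟩)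
    have := k.isLt
    simp only [Set.mem_ofPred_eq] at hv ⊢
    rw [List.length_eraseIdx_of_lt this]
    omega
  | zero => simp
  | add x y _ _ hx hy => rw [map_add]; exact Submodule.add_mem _ hx hy
  | smul c x _ hx => rw [map_smul]; exact Submodule.smul_mem _ _ hx

theorem annihilator_creator (f : H) (x : PreFock q H) :
    annihilator f (creator f x) = ((‖f‖ ^ 2 : ℝ) : ℂ) • x + (q : ℂ) • creator f (annihilator f x) := by
  induction x using PreFock.induction with
  | h0 => simp
  | hadd x x' hx hx' => simp only [map_add, hx, hx', smul_add]; abel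
  | hword d v =>
    simp only [map_smul, creator_word, annihilator_word]
    rw [smul_comm _ d, smul_comm _ d, ← smul_add]
    congr 1
    refine (Fin.sum_univ_succ _).trans ?_
    congr 1
    · simp [inner_self_eq_norm_sq_to_K]
    · rw [map_sum, Finset.smul_sum]
      refine Finset.sum_congr rfl fun k _ => ?_
      rw [map_smul, creator_word, smul_smul]
      simp [pow_succ', mul_assoc]

end algebra

section inner

variable (q : ℝ) {H : Type} [NormedAddCommGroup H] [InnerProductSpace ℂ H] [hq : Fact (|q| < 1)]

/-- The `q`-inner product makes the algebraic Fock space a pre-Hilbert space. -/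
noncomputable abbrev core : PreInnerProductSpace.Core ℂ (PreFock q H) where
  inner := finForm q
  conj_inner_symm := conj_finForm q
  re_inner_nonneg x := (Complex.nonneg_iff.1 (finForm_self_nonneg q hq.out.le x)).1
  add_left := finForm_add_left q
  smul_left := finForm_smul_left q

noncomputable instance : SeminormedAddCommGroup (PreFock q H) :=
  InnerProductSpace.Core.toSeminormedAddCommGroup (c := core q)
noncomputable instance : InnerProductSpace ℂ (PreFock q H) :=
  InnerProductSpace.ofCore (core q)

variable {q}

theorem inner_word (u v : List H) : inner ℂ (word q u) (word q v) = wordForm q u v := by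
  change finForm q (Finsupp.single u 1) (Finsupp.single v 1) = _
  simp [finForm]

theorem inner_creator (f : H) (x y : PreFock q H) :
    inner ℂ (creator f x) y = inner ℂ x (annihilator f y) := by
  induction x using PreFock.induction with
  | h0 => simp
  | hadd x x' hx hx' => simp [inner_add_left, hx, hx']
  | hword c u =>
    induction y using PreFock.induction with
    | h0 => simp
    | hadd y y' hy hy' => rw [map_add, inner_add_right, inner_add_right, hy, hy']
    | hword d v =>
      simp only [map_smul, inner_smul_left, inner_smul_right, creator_word, annihilator_word,
        inner_word, inner_sum, wordForm_cons, Finset.mul_sum]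
      refine Finset.sum_congr rfl fun k _ => ?_
      ring

theorem norm_creator_sq_le (f : H) (n : ℕ) : ∀ x : PreFock q H,
    x ∈ Submodule.span ℂ (word q '' {u : List H | u.length < n}) →
    ‖creator f x‖ ^ 2 ≤ ‖f‖ ^ 2 / (1 - |q|) * ‖x‖ ^ 2 := by
  have hq1 : 0 < 1 - |q| := sub_pos.2 hq.out
  set C := ‖f‖ ^ 2 / (1 - |q|) with hC
  have hC0 : 0 ≤ C := by positivity
  have hC1 : ‖f‖ ^ 2 + |q| * C = C := by rw [hC]; field_simp; ring
  induction n with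
  | zero =>
    intro x hx
    have : x = 0 := by simpa using hx
    simp [this]
  | succ n ih =>
    intro x hx
    set y := annihilator f x with hy
    have h1 : ‖y‖ ^ 2 ≤ ‖creator f y‖ * ‖x‖ := by
      have : inner ℂ (creator f y) x = ((‖y‖ ^ 2 : ℝ) : ℂ) := by
        rw [inner_creator, ← hy, inner_self_eq_norm_sq_to_K]
        simp
      have h := norm_inner_le_norm (𝕜 := ℂ) (creator f y) x
      rw [this] at h
      simpa using h
    have h2 := ih y (annihilator_mem f n x hx)
    have h3 : ‖y‖ ^ 2 ≤ C * ‖x‖ ^ 2 := by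
      rcases (norm_nonneg y).eq_or_lt with h0 | h0
      · rw [← h0, zero_pow two_ne_zero]; positivity
      · have h4 : (‖y‖ ^ 2) ^ 2 ≤ C * ‖y‖ ^ 2 * ‖x‖ ^ 2 := by
          calc (‖y‖ ^ 2) ^ 2 ≤ (‖creator f y‖ * ‖x‖) ^ 2 := by gcongr
            _ = ‖creator f y‖ ^ 2 * ‖x‖ ^ 2 := by ring
            _ ≤ _ := by gcongr
        have h5 : 0 < ‖y‖ ^ 2 := pow_pos h0 2
        refine le_of_mul_le_mul_left ?_ h5
        linarith
    have h4 : ‖creator f x‖ ^ 2 = ‖f‖ ^ 2 * ‖x‖ ^ 2 + q * ‖y‖ ^ 2 := by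
      have h : (inner ℂ (creator f x) (creator f x) : ℂ) =
          ((‖f‖ ^ 2 * ‖x‖ ^ 2 + q * ‖y‖ ^ 2 : ℝ) : ℂ) := by
        rw [inner_creator, annihilator_creator, inner_add_right, inner_smul_right, inner_smul_right,
          ← hy, ← inner_conj_symm x (creator f y), inner_creator, ← hy, inner_self_eq_norm_sq_to_K,
          inner_self_eq_norm_sq_to_K]
        simp
      rw [inner_self_eq_norm_sq_to_K] at h
      exact Complex.ofReal_injective (by rw [← h]; simp)
    have h5 : q * ‖y‖ ^ 2 ≤ |q| * (C * ‖x‖ ^ 2) :=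
      mul_le_mul (le_abs_self q) h3 (by positivity) (abs_nonneg q)
    calc ‖creator f x‖ ^ 2 ≤ (‖f‖ ^ 2 + |q| * C) * ‖x‖ ^ 2 := by rw [h4]; linarith
      _ = C * ‖x‖ ^ 2 := by rw [hC1]

theorem norm_creator_le (f : H) (x : PreFock q H) :
    ‖creator f x‖ ≤ √(‖f‖ ^ 2 / (1 - |q|)) * ‖x‖ := by
  obtain ⟨n, hn⟩ := exists_mem_span x
  have hq1 : 0 < 1 - |q| := sub_pos.2 hq.out
  refine le_of_sq_le_sq ?_ (by positivity)
  rw [mul_pow, Real.sq_sqrt (by positivity)]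
  exact norm_creator_sq_le f n x hn

theorem inner_gamma (S : H →ₗᵢ[ℂ] H) (x y : PreFock q H) :
    inner ℂ (gamma S x) (gamma S y) = inner ℂ x y := by
  induction x using PreFock.induction with
  | h0 => simp
  | hadd x x' hx hx' => simp only [map_add, inner_add_left, hx, hx']
  | hword c u =>
    induction y using PreFock.induction with
    | h0 => simp
    | hadd y y' hy hy' => rw [map_add, inner_add_right, inner_add_right, hy, hy']
    | hword d v =>
      simp only [map_smul, inner_smul_left, inner_smul_right, gamma_word, inner_word, wordForm_map]

theorem norm_gamma (S : H →ₗᵢ[ℂ] H) (x : PreFock q H) : ‖gamma S x‖ = ‖x‖ := by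
  rw [norm_eq_sqrt_re_inner (𝕜 := ℂ), inner_gamma, ← norm_eq_sqrt_re_inner]

end inner

end PreFock

/-! ### The `q`-deformed Fock space and its operators -/

section fock

variable (q : ℝ) [hq : Fact (|q| < 1)] {H : Type} [NormedAddCommGroup H] [InnerProductSpace ℂ H]

variable (H) in
/-- The `q`-deformed Fock space over `H`: the completion of the algebraic Fock space. -/
def Fock : Type := UniformSpace.Completion (PreFock q H)

noncomputable instance : NormedAddCommGroup (Fock q H) :=
  inferInstanceAs (NormedAddCommGroup (UniformSpace.Completion (PreFock q H)))
noncomputable instance : InnerProductSpace ℂ (Fock q H) :=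
  inferInstanceAs (InnerProductSpace ℂ (UniformSpace.Completion (PreFock q H)))
instance : CompleteSpace (Fock q H) :=
  inferInstanceAs (CompleteSpace (UniformSpace.Completion (PreFock q H)))

/-- The canonical isometric map of the algebraic Fock space into its completion. -/
noncomputable def Fock.incl : PreFock q H →ₗᵢ[ℂ] Fock q H :=
  UniformSpace.Completion.toComplₗᵢ

theorem Fock.denseRange_incl : DenseRange (Fock.incl q (H := H)) :=
  UniformSpace.Completion.denseRange_coe

/-- The continuous extension of a bounded operator to the completion. -/
noncomputable def Fock.extend (T : PreFock q H →L[ℂ] PreFock q H) : Fock q H →L[ℂ] Fock q H :=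
  T.completion

theorem Fock.extend_incl (T : PreFock q H →L[ℂ] PreFock q H) (x : PreFock q H) :
    Fock.extend q T (Fock.incl q x) = Fock.incl q (T x) :=
  T.completion_apply_coe x

/-- The vector `f₁ ⊗ ⋯ ⊗ fₙ` of the `q`-deformed Fock space. -/
noncomputable def tensor (u : List H) : Fock q H := Fock.incl q (PreFock.word q u)

theorem inner_tensor (u v : List H) : inner ℂ (tensor q u) (tensor q v) = wordForm q u v :=
  ((Fock.incl q).inner_map_map _ _).trans (PreFock.inner_word u v)

variable (H) in
/-- The vacuum vector. -/
noncomputable def vacuum : Fock q H := tensor q []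

/-- The creation operator `a⁺(f)`, determined by `a⁺(f) (f₁ ⊗ ⋯ ⊗ fₙ) = f ⊗ f₁ ⊗ ⋯ ⊗ fₙ`. -/
noncomputable def creator (f : H) : Fock q H →L[ℂ] Fock q H :=
  Fock.extend q (LinearMap.mkContinuous (PreFock.creator f) (√(‖f‖ ^ 2 / (1 - |q|)))
    (PreFock.norm_creator_le f))

theorem creator_tensor (f : H) (u : List H) : creator q f (tensor q u) = tensor q (f :: u) := by
  rw [creator, tensor, Fock.extend_incl, LinearMap.mkContinuous_apply, PreFock.creator_word, tensor]

/-- The annihilation operator `a(f)`, the adjoint of `a⁺(f)`. -/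
noncomputable def annihilator (f : H) : Fock q H →L[ℂ] Fock q H := star (creator q f)

/-- `f₁ ⊗ ⋯ ⊗ fₙ ↦ S f₁ ⊗ ⋯ ⊗ S fₙ` as a bounded operator, for an isometry `S` of `H`. -/
noncomputable def gamma (S : H →ₗᵢ[ℂ] H) : Fock q H →L[ℂ] Fock q H :=
  Fock.extend q (LinearMap.mkContinuous (PreFock.gamma S) 1
    fun x => by rw [PreFock.norm_gamma, one_mul])

theorem gamma_incl (S : H →ₗᵢ[ℂ] H) (x : PreFock q H) :
    gamma q S (Fock.incl q x) = Fock.incl q (PreFock.gamma S x) := by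
  rw [gamma, Fock.extend_incl, LinearMap.mkContinuous_apply]

theorem gamma_tensor (S : H →ₗᵢ[ℂ] H) (u : List H) :
    gamma q S (tensor q u) = tensor q (u.map S) := by
  rw [tensor, gamma_incl, PreFock.gamma_word, tensor]

variable {q} in
theorem ext_tensor {T T' : Fock q H →L[ℂ] Fock q H}
    (h : ∀ u, T (tensor q u) = T' (tensor q u)) : T = T' := by
  refine ContinuousLinearMap.coeFn_injective
    ((Fock.denseRange_incl q).equalizer T.continuous T'.continuous (funext fun x => ?_))
  change T (Fock.incl q x) = T' (Fock.incl q x)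
  induction x using PreFock.induction with
  | h0 => rw [map_zero, map_zero, map_zero]
  | hadd x y hx hy => rw [map_add, map_add, map_add, hx, hy]
  | hword c u =>
    rw [map_smul, map_smul, map_smul]
    exact congrArg _ (h u)

theorem inner_gamma (S : H →ₗᵢ[ℂ] H) (x y : Fock q H) :
    inner ℂ (gamma q S x) (gamma q S y) = inner ℂ x y := by
  have hc := (gamma q S).continuous
  refine (Fock.denseRange_incl q).induction_on₂
    (isClosed_eq ((hc.comp continuous_fst).inner (hc.comp continuous_snd))
      (continuous_fst.inner continuous_snd)) (fun x y => ?_) x y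
  rw [gamma_incl, gamma_incl, LinearIsometry.inner_map_map, LinearIsometry.inner_map_map,
    PreFock.inner_gamma]

theorem gamma_mul_gamma_symm (S : H ≃ₗᵢ[ℂ] H) :
    gamma q S.toLinearIsometry * gamma q S.symm.toLinearIsometry = 1 := by
  refine ext_tensor fun u => ?_
  simp [gamma_tensor, Function.comp_def]

theorem star_gamma (S : H ≃ₗᵢ[ℂ] H) :
    star (gamma q S.toLinearIsometry) = gamma q S.symm.toLinearIsometry := by
  symm
  refine (ContinuousLinearMap.eq_adjoint_iff _ _).2 fun x y => ?_
  rw [← inner_gamma q S.toLinearIsometry, ← mul_apply_eq_comp, gamma_mul_gamma_symm]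
  rfl

/-- The second quantization of a unitary `S` of `H`, a unitary of the Fock space. -/
noncomputable def secondQuantization (S : H ≃ₗᵢ[ℂ] H) : unitary (Fock q H →L[ℂ] Fock q H) :=
  ⟨gamma q S.toLinearIsometry, by
    rw [Unitary.mem_iff, star_gamma]
    exact ⟨gamma_mul_gamma_symm q S.symm, gamma_mul_gamma_symm q S⟩⟩

/-- Conjugation by the second quantization of `S`. -/
noncomputable def conjAut (S : H ≃ₗᵢ[ℂ] H) :
    (Fock q H →L[ℂ] Fock q H) ≃⋆ₐ[ℂ] (Fock q H →L[ℂ] Fock q H) :=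
  Unitary.conjStarAlgAut ℂ _ (secondQuantization q S)

theorem conjAut_creator (S : H ≃ₗᵢ[ℂ] H) (f : H) :
    conjAut q S (creator q f) = creator q (S f) := by
  rw [conjAut, Unitary.conjStarAlgAut_apply]
  refine ext_tensor fun u => ?_
  simp [secondQuantization, star_gamma, gamma_tensor, creator_tensor, Function.comp_def]

theorem conjAut_annihilator (S : H ≃ₗᵢ[ℂ] H) (f : H) :
    conjAut q S (annihilator q f) = annihilator q (S f) := by
  exact ((conjAut q S).map_star' (creator q f)).trans (congrArg star (conjAut_creator q S f))

theorem conjAut_symm (S : H ≃ₗᵢ[ℂ] H) : (conjAut q S).symm = conjAut q S.symm := by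
  rw [conjAut, Unitary.conjStarAlgAut_symm, conjAut]
  congr 1
  exact Subtype.ext (star_gamma q S)

theorem continuous_conjAut (S : H ≃ₗᵢ[ℂ] H) : Continuous (conjAut q S) := by
  exact (continuous_const.mul continuous_id).mul continuous_const

end fock

/-! ### `C*`-algebras and dynamical systems -/

section cstar

variable {B : Type} [CStarAlgebra B]

/-- The unital `C*`-subalgebra of `B` generated by `s`. -/
noncomputable def generatedCStar (s : Set B) : StarSubalgebra ℂ B :=
  (StarAlgebra.adjoin ℂ s).topologicalClosure

noncomputable instance (s : Set B) : CStarAlgebra (generatedCStar s) :=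
  StarSubalgebra.cstarAlgebra _ (h_closed := StarSubalgebra.isClosed_topologicalClosure _)

theorem subset_generatedCStar (s : Set B) : s ⊆ generatedCStar s :=
  (StarAlgebra.subset_adjoin ℂ s).trans (StarSubalgebra.le_topologicalClosure _)

theorem generatedCStar_le {s : Set B} {T : StarSubalgebra ℂ B} (hT : IsClosed (T : Set B))
    (h : s ⊆ T) : generatedCStar s ≤ T :=
  StarSubalgebra.topologicalClosure_minimal (StarAlgebra.adjoin_le h) hT

theorem map_mem_generatedCStar {s : Set B} (φ : B ≃⋆ₐ[ℂ] B) (hφ : Continuous φ)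
    (h : ∀ x ∈ s, φ x ∈ s) {x : B} (hx : x ∈ generatedCStar s) : φ x ∈ generatedCStar s := by
  have : generatedCStar s ≤ (generatedCStar s).comap (φ : B →⋆ₐ[ℂ] B) :=
    generatedCStar_le ((StarSubalgebra.isClosed_topologicalClosure _).preimage hφ)
      fun x hx => subset_generatedCStar s (h x hx)
  exact this hx

/-- The restriction of an automorphism `φ` of `B` to the `C*`-subalgebra generated by a set `s`,
when it maps this subalgebra onto itself. -/
noncomputable def restrictAut (s : Set B) (φ : B ≃⋆ₐ[ℂ] B)
    (h : ∀ x ∈ generatedCStar s, φ x ∈ generatedCStar s)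
    (h' : ∀ x ∈ generatedCStar s, φ.symm x ∈ generatedCStar s) :
    generatedCStar s ≃⋆ₐ[ℂ] generatedCStar s where
  toFun x := ⟨φ x, h x x.2⟩
  invFun x := ⟨φ.symm x, h' x x.2⟩
  left_inv x := by simp
  right_inv x := by simp
  map_mul' x y := Subtype.ext (map_mul φ (x : B) y)
  map_add' x y := Subtype.ext (map_add φ (x : B) y)
  map_star' x := Subtype.ext (map_star φ (x : B))
  map_smul' c x := Subtype.ext (map_smul φ c (x : B))

theorem coe_restrictAut (s : Set B) (φ : B ≃⋆ₐ[ℂ] B)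
    (h : ∀ x ∈ generatedCStar s, φ x ∈ generatedCStar s)
    (h' : ∀ x ∈ generatedCStar s, φ.symm x ∈ generatedCStar s) (x : generatedCStar s) :
    (restrictAut s φ h h' x : B) = φ x := rfl

variable {A : Type} [CStarAlgebra A]

/-- States: positive linear functionals with value `1` at the unit. -/
def IsState (φ : A →L[ℂ] ℂ) : Prop := φ 1 = 1 ∧ ∀ x, 0 ≤ φ (star x * x)

/-- Unique mixing of the `C*`-dynamical system `(A, α)`: there is a state `ω` such that
`φ(αⁿ(x)) → φ(1) ω(x)` for all `x ∈ A` and all bounded linear functionals `φ` on `A`. -/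
def UniquelyMixing (α : A ≃⋆ₐ[ℂ] A) : Prop :=
  ∃ ω : A →L[ℂ] ℂ, IsState ω ∧ ∀ (φ : A →L[ℂ] ℂ) (x : A),
    Filter.Tendsto (fun n : ℕ => φ (α^[n] x)) Filter.atTop (nhds (φ 1 * ω x))

/-- Invariance of a functional under an automorphism. -/
def IsInvariant (α : A ≃⋆ₐ[ℂ] A) (φ : A →L[ℂ] ℂ) : Prop := ∀ x, φ (α x) = φ x

/-- Traces. -/
def IsTracial (φ : A →L[ℂ] ℂ) : Prop := ∀ x y, φ (x * y) = φ (y * x)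

/-- Faithfulness. -/
def IsFaithful (φ : A →L[ℂ] ℂ) : Prop := ∀ x, φ (star x * x) = 0 → x = 0

end cstar

/-! ### The shift on `ℓ²(ℤ)` and on the `C*`-algebras of the `q`-commutation relations -/

/-- The Hilbert space `ℓ²(ℤ)`. -/
abbrev EllTwoZ : Type := lp (fun _ : ℤ => ℂ) 2

/-- The canonical orthonormal basis of `ℓ²(ℤ)`. -/
noncomputable def stdVec (i : ℤ) : EllTwoZ := lp.single 2 i 1

/-- Translation by `k` on `ℓ²(ℤ)`. -/
noncomputable def translation (k : ℤ) : EllTwoZ →ₗᵢ[ℂ] EllTwoZ where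
  toFun f := ⟨fun n => f (n - k), by
    have h := (memℓp_gen_iff (by simp)).1 (lp.memℓp f)
    exact memℓp_gen ((Equiv.subRight k).summable_iff.2 h)⟩
  map_add' _ _ := rfl
  map_smul' _ _ := rfl
  norm_map' f := by
    rw [lp.norm_eq_tsum_rpow (by simp), lp.norm_eq_tsum_rpow (by simp)]
    exact congrArg (· ^ _) ((Equiv.subRight k).tsum_eq fun n => ‖f n‖ ^ (2 : ENNReal).toReal)

/-- The right shift `(f n)ₙ ↦ (f (n - 1))ₙ`, which sends `eᵢ` to `eᵢ₊₁`. -/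
noncomputable def rightShift : EllTwoZ ≃ₗᵢ[ℂ] EllTwoZ where
  toLinearEquiv := LinearEquiv.ofLinearMap (translation 1).toLinearMap
    (translation (-1)).toLinearMap
    (LinearMap.ext fun f => lp.ext (funext fun n => congrArg f (by ring : n - 1 - (-1) = n)))
    (LinearMap.ext fun f => lp.ext (funext fun n => congrArg f (by ring : n - (-1) - 1 = n)))
  norm_map' f := (translation 1).norm_map f

theorem rightShift_stdVec (i : ℤ) : rightShift (stdVec i) = stdVec (i + 1) := by
  ext n
  change stdVec i (n - 1) = _
  simp only [stdVec, lp.single_apply]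
  grind

theorem rightShift_symm_stdVec (i : ℤ) : rightShift.symm (stdVec i) = stdVec (i - 1) := by
  rw [LinearIsometryEquiv.symm_apply_eq, rightShift_stdVec, sub_add_cancel]

section main

variable (q : ℝ) [hq : Fact (|q| < 1)]

/-- The `q`-annihilators `aᵢ`. -/
noncomputable def a (i : ℤ) : Fock q EllTwoZ →L[ℂ] Fock q EllTwoZ := annihilator q (stdVec i)

/-- The `q`-creators `aᵢ⁺`. -/
noncomputable def aPlus (i : ℤ) : Fock q EllTwoZ →L[ℂ] Fock q EllTwoZ := creator q (stdVec i)

theorem star_aPlus (i : ℤ) : star (aPlus q i) = a q i := rfl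

/-- The `C*`-algebra generated by the `aᵢ`. -/
noncomputable abbrev algR : StarSubalgebra ℂ (Fock q EllTwoZ →L[ℂ] Fock q EllTwoZ) :=
  generatedCStar (Set.range (a q))

/-- The `C*`-algebra generated by the self-adjoint `q`-Gaussians `aᵢ + aᵢ⁺`. -/
noncomputable abbrev algG : StarSubalgebra ℂ (Fock q EllTwoZ →L[ℂ] Fock q EllTwoZ) :=
  generatedCStar (Set.range fun i => a q i + aPlus q i)

theorem a_mem (i : ℤ) : a q i ∈ algR q := subset_generatedCStar _ ⟨i, rfl⟩

theorem algG_le_algR : algG q ≤ algR q := by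
  refine generatedCStar_le (StarSubalgebra.isClosed_topologicalClosure _) ?_
  rintro _ ⟨i, rfl⟩
  have h := star_mem (a_mem q i)
  rw [← star_aPlus, star_star] at h
  exact add_mem (a_mem q i) h

theorem conjAut_rightShift_a (i : ℤ) : conjAut q rightShift (a q i) = a q (i + 1) := by
  rw [a, conjAut_annihilator, rightShift_stdVec, a]

theorem conjAut_rightShift_aPlus (i : ℤ) : conjAut q rightShift (aPlus q i) = aPlus q (i + 1) := by
  rw [aPlus, conjAut_creator, rightShift_stdVec, aPlus]

theorem conjAut_symm_a (i : ℤ) : (conjAut q rightShift).symm (a q i) = a q (i - 1) := by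
  rw [conjAut_symm, a, conjAut_annihilator, rightShift_symm_stdVec, a]

theorem conjAut_symm_aPlus (i : ℤ) : (conjAut q rightShift).symm (aPlus q i) = aPlus q (i - 1) := by
  rw [conjAut_symm, aPlus, conjAut_creator, rightShift_symm_stdVec, aPlus]

/-- The right shift `α` on `algR`, implemented by the second quantization of the right shift of
`ℓ²(ℤ)`; it is determined by its values `shiftR_a` on the generators. -/
noncomputable def shiftR : algR q ≃⋆ₐ[ℂ] algR q :=
  restrictAut (Set.range (a q)) (conjAut q rightShift)
    (fun _ hx => map_mem_generatedCStar _ (continuous_conjAut q _)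
      (by rintro _ ⟨i, rfl⟩; exact ⟨i + 1, (conjAut_rightShift_a q i).symm⟩) hx)
    (fun _ hx => map_mem_generatedCStar _ (by rw [conjAut_symm]; exact continuous_conjAut q _)
      (by rintro _ ⟨i, rfl⟩; exact ⟨i - 1, (conjAut_symm_a q i).symm⟩) hx)

theorem shiftR_a (i : ℤ) : shiftR q ⟨a q i, a_mem q i⟩ = ⟨a q (i + 1), a_mem q (i + 1)⟩ :=
  Subtype.ext ((coe_restrictAut _ _ _ _ _).trans (conjAut_rightShift_a q i))

/-- The restriction of the right shift to `algG`; see `coe_shiftG`. -/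
noncomputable def shiftG : algG q ≃⋆ₐ[ℂ] algG q :=
  restrictAut (Set.range fun i => a q i + aPlus q i) (conjAut q rightShift)
    (fun _ hx => map_mem_generatedCStar _ (continuous_conjAut q _) (by
      rintro _ ⟨i, rfl⟩
      refine ⟨i + 1, ?_⟩
      beta_reduce
      rw [← conjAut_rightShift_a, ← conjAut_rightShift_aPlus]
      exact ((conjAut q rightShift).map_add' _ _).symm) hx)
    (fun _ hx => map_mem_generatedCStar _ (by rw [conjAut_symm]; exact continuous_conjAut q _) (by
      rintro _ ⟨i, rfl⟩
      refine ⟨i - 1, ?_⟩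
      beta_reduce
      rw [← conjAut_symm_a, ← conjAut_symm_aPlus]
      exact ((conjAut q rightShift).symm.map_add' _ _).symm) hx)

theorem coe_shiftG (x : algG q) :
    (shiftG q x : Fock q EllTwoZ →L[ℂ] Fock q EllTwoZ) = shiftR q ⟨x, algG_le_algR q x.2⟩ := by
  rw [shiftG, shiftR, coe_restrictAut, coe_restrictAut]

/-- The vacuum expectation `x ↦ ⟨x Ω, Ω⟩` on `algG` (linear in `x`). -/
noncomputable def vacuumG : algG q →L[ℂ] ℂ :=
  (innerSL ℂ (vacuum q EllTwoZ)) ∘L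
    (ContinuousLinearMap.apply ℂ (Fock q EllTwoZ) (vacuum q EllTwoZ)) ∘L
      (algG q).toSubalgebra.toSubmodule.subtypeL

theorem vacuumG_apply (x : algG q) : vacuumG q x = inner ℂ (vacuum q EllTwoZ)
    ((x : Fock q EllTwoZ →L[ℂ] Fock q EllTwoZ) (vacuum q EllTwoZ)) := rfl

end main

end QGaussian

/-!
Everything rests on two features of the `q`-Gaussians `sᵢ = aᵢ + aᵢ⁺`.

*Mixing.* The relation `aᵢ aⱼ⁺ = δᵢⱼ + q aⱼ⁺ aᵢ` rewrites every polynomial in the `sᵢ` as a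
combination of normally ordered words `c b`, with `c` a product of creators and `b` a product of
annihilators (`adjoin_gaussian_subset_normallyOrdered`). The same relation gives a bound on
`M = ‖∑ᵢ aᵢ⁺ aᵢ‖` over finite sets of indices: squaring the sum yields `M² ≤ M + |q| M²`, so
`M ≤ 1 / (1 - |q|)` (`norm_sum_creator_mul_annihilator_le`). Hence, for a bounded sequence `yₙ`,
`‖∑ₙ cₙ aᵢ₊ₙ⁺ yₙ‖` is at most a constant times `(∑ₙ |cₙ|²)^(1/2)`, so that a bounded functional is
square summable along `aᵢ₊ₙ⁺ yₙ`, and in particular tends to zero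
(`tendsto_zero_of_norm_sum_le`). This applies to the shifts of every normally ordered word that
starts with a creator, and by taking adjoints to those of every one that ends with an annihilator.
The vacuum expectation of such words vanishes, and the only other normally ordered word is `1`.
Since the shift is isometric, the convergence `φ(αⁿ(x)) → φ(1) ω(x)` passes to norm limits, and
by the Hahn–Banach theorem functionals on the `C*`-algebra may be taken on all bounded operators.
An invariant state is equal to its limit along the shift, hence to `ω`.

*Trace and faithfulness.* Reversal of words is a unitary of the Fock space; it carries the `sᵢ` to
operators `dᵢ` that create and annihilate on the right. The `dᵢ` commute with the `sⱼ`
(`commute_gaussian`), are self-adjoint, and satisfy `dᵢ Ω = sᵢ Ω`; therefore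
`⟨Ω, y sᵢ Ω⟩ = ⟨Ω, y dᵢ Ω⟩ = ⟨Ω, dᵢ y Ω⟩ = ⟨sᵢ Ω, y Ω⟩`, and `ω` is a trace. The vacuum is cyclic,
because `sᵢ w` is `eᵢ ⊗ w` up to shorter words. If `x Ω = 0`, then traciality gives
`‖x y Ω‖² = ⟨Ω, x* x y y* Ω⟩ = 0` for all `y`, and cyclicity gives `x = 0`.
-/

namespace QGaussian

/-! ### Creation and annihilation operators -/

section operators

variable {q : ℝ} [hq : Fact (|q| < 1)] {H : Type} [NormedAddCommGroup H] [InnerProductSpace ℂ H]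

/-- The adjoint of the creator is given on the algebraic Fock space by the explicit formula of
`PreFock.annihilator`. -/
theorem annihilator_incl (f : H) (y : PreFock q H) :
    annihilator q f (Fock.incl q y) = Fock.incl q (PreFock.annihilator f y) := by
  refine ext_inner_left ℂ fun w => ?_
  have h : inner ℂ w (annihilator q f (Fock.incl q y)) =
      inner ℂ (creator q f w) (Fock.incl q y) :=
    ContinuousLinearMap.adjoint_inner_right _ _ _
  rw [h]
  refine (Fock.denseRange_incl q).induction_on w
    (isClosed_eq ((creator q f).continuous.inner continuous_const)
      (continuous_id.inner continuous_const)) fun x => ?_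
  rw [creator, Fock.extend_incl, LinearMap.mkContinuous_apply, LinearIsometry.inner_map_map,
    LinearIsometry.inner_map_map, PreFock.inner_creator]

theorem annihilator_tensor (f : H) (v : List H) :
    annihilator q f (tensor q v) =
      ∑ k : Fin v.length, ((q : ℂ) ^ (k : ℕ) * inner ℂ f (v.get k)) •
        tensor q (v.eraseIdx k) := by
  rw [tensor, annihilator_incl, PreFock.annihilator_word, map_sum]
  simp only [map_smul, tensor]

theorem annihilator_vacuum (f : H) : annihilator q f (vacuum q H) = 0 :=
  annihilator_tensor f []

theorem norm_vacuum : ‖vacuum q H‖ = 1 := by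
  have h : inner ℂ (vacuum q H) (vacuum q H) = (1 : ℂ) := by
    rw [vacuum, inner_tensor, wordForm_eq q (n := 0) rfl rfl]
    simp [tensorForm, inversions]
  rw [norm_eq_sqrt_re_inner (𝕜 := ℂ), h]
  simp

/-- The `q`-commutation relation. -/
theorem annihilator_mul_creator (f g : H) :
    annihilator q f * creator q g =
      (inner ℂ f g : ℂ) • 1 + (q : ℂ) • (creator q g * annihilator q f) := by
  refine ext_tensor fun u => ?_
  simp only [mul_apply_eq_comp, add_apply,
    smul_apply, one_apply_eq_self, creator_tensor, annihilator_tensor]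
  refine (Fin.sum_univ_succ _).trans ?_
  congr 1
  · simp
  · rw [map_sum, Finset.smul_sum]
    refine Finset.sum_congr rfl fun k _ => ?_
    rw [map_smul, creator_tensor, smul_smul]
    simp [pow_succ', mul_assoc]

/-- Words that differ by a multilinearity relation agree in the completion, so creators are linear
in the vector. This is read off from the formula for the annihilators. -/
theorem creator_add (f g : H) : creator q (f + g) = creator q f + creator q g := by
  refine star_injective ?_
  rw [star_add]
  refine ext_tensor fun u => ?_
  have h : ∀ f : H, star (creator q f) = annihilator q f := fun _ => rfl
  simp only [h, add_apply, annihilator_tensor, inner_add_left, mul_add,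
    add_smul, Finset.sum_add_distrib]

theorem creator_smul (c : ℂ) (f : H) : creator q (c • f) = c • creator q f := by
  refine star_injective ?_
  rw [star_smul]
  refine ext_tensor fun u => ?_
  have h : ∀ f : H, star (creator q f) = annihilator q f := fun _ => rfl
  simp only [h, smul_apply, annihilator_tensor, inner_smul_left,
    Finset.smul_sum, smul_smul]
  refine Finset.sum_congr rfl fun k _ => ?_
  rw [mul_left_comm]
  rfl

theorem norm_creator_le (f : H) : ‖creator q f‖ ≤ √(1 / (1 - |q|)) * ‖f‖ := by
  have hq1 : 0 < 1 - |q| := sub_pos.2 hq.out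
  refine ContinuousLinearMap.opNorm_le_bound _ (by positivity) fun x => ?_
  refine (Fock.denseRange_incl q).induction_on x
    (isClosed_le ((creator q f).continuous.norm) (continuous_const.mul continuous_norm))
    fun y => ?_
  rw [creator, Fock.extend_incl, LinearMap.mkContinuous_apply, LinearIsometry.norm_map,
    LinearIsometry.norm_map]
  refine (PreFock.norm_creator_le f y).trans_eq ?_
  rw [div_eq_mul_one_div, mul_comm, Real.sqrt_mul (by positivity), Real.sqrt_sq (norm_nonneg f)]
  ring

/-- The vector `f ⊗ x`, as a bounded linear function of `f`. -/
noncomputable def creatorMap (x : Fock q H) : H →L[ℂ] Fock q H :=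
  LinearMap.mkContinuous
    { toFun := fun f => creator q f x
      map_add' := fun f g => by rw [creator_add, add_apply]
      map_smul' := fun c f => by
        rw [creator_smul, smul_apply, RingHom.id_apply] }
    (√(1 / (1 - |q|)) * ‖x‖) fun f =>
      ((creator q f).le_opNorm x).trans <|
        (mul_le_mul_of_nonneg_right (norm_creator_le f) (norm_nonneg x)).trans_eq (by ring)

end operators

/-! ### Reversal of words and creation on the right -/

section reversal

/-- Reversal of words on the algebraic Fock space. -/
noncomputable def PreFock.reversal (q : ℝ) {H : Type} : PreFock q H →ₗ[ℂ] PreFock q H :=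
  Finsupp.lmapDomain ℂ ℂ List.reverse

theorem PreFock.reversal_word (q : ℝ) {H : Type} (u : List H) :
    PreFock.reversal q (word q u) = word q u.reverse :=
  Finsupp.mapDomain_single

/-- Conjugation by the order-reversing permutation maps an inversion `(i, j)` to
`(n - 1 - j, n - 1 - i)`. -/
theorem inversions_conj_rev {n : ℕ} (π : Equiv.Perm (Fin n)) :
    inversions (Fin.revPerm * π * Fin.revPerm) = inversions π := by
  unfold inversions
  refine Finset.card_nbij' (fun p => (p.2.rev, p.1.rev)) (fun p => (p.2.rev, p.1.rev))
    ?_ ?_ ?_ ?_ <;> simp +contextual [Set.MapsTo, Set.LeftInvOn]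

variable {H : Type} [NormedAddCommGroup H] [InnerProductSpace ℂ H]

theorem tensorForm_rev (q : ℝ) (n : ℕ) (f g : Fin n → H) :
    tensorForm q n (fun k => f k.rev) (fun k => g k.rev) = tensorForm q n f g := by
  unfold tensorForm
  let E : Equiv.Perm (Fin n) ≃ Equiv.Perm (Fin n) :=
    (Equiv.mulLeft Fin.revPerm).trans (Equiv.mulRight Fin.revPerm)
  rw [← Equiv.sum_comp E]
  refine Finset.sum_congr rfl fun π _ => ?_
  have hE : E π = Fin.revPerm * π * Fin.revPerm := rfl
  rw [hE, inversions_conj_rev]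
  congr 1
  rw [← Equiv.prod_comp Fin.revPerm]
  simp

theorem wordForm_reverse (q : ℝ) (u v : List H) :
    wordForm q u.reverse v.reverse = wordForm q u v := by
  by_cases h : u.length = v.length
  · rw [wordForm_eq q (n := v.length) (by simpa) (by simp), wordForm_eq q h rfl, ← tensorForm_rev]
    congr 1 <;> ext k <;>
      simp only [List.get_eq_getElem, Fin.val_cast, List.getElem_reverse, Fin.val_rev] <;>
      congr 1 <;> omega
  · rw [wordForm_of_length_ne q h, wordForm_of_length_ne q (by simpa using h)]

variable (q : ℝ) [hq : Fact (|q| < 1)]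

theorem PreFock.inner_reversal (x y : PreFock q H) :
    inner ℂ (reversal q x) (reversal q y) = inner ℂ x y := by
  induction x using PreFock.induction with
  | h0 => simp
  | hadd x x' hx hx' => simp only [map_add, inner_add_left, hx, hx']
  | hword c u =>
    induction y using PreFock.induction with
    | h0 => simp
    | hadd y y' hy hy' => rw [map_add, inner_add_right, inner_add_right, hy, hy']
    | hword d v =>
      simp only [map_smul, inner_smul_left, inner_smul_right, reversal_word, inner_word,
        wordForm_reverse]

theorem PreFock.norm_reversal (x : PreFock q H) : ‖reversal q x‖ = ‖x‖ := by
  rw [norm_eq_sqrt_re_inner (𝕜 := ℂ), inner_reversal, ← norm_eq_sqrt_re_inner]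

variable (H) in
/-- The self-adjoint unitary `f₁ ⊗ ⋯ ⊗ fₙ ↦ fₙ ⊗ ⋯ ⊗ f₁` of the Fock space. -/
noncomputable def reversal : Fock q H →L[ℂ] Fock q H :=
  Fock.extend q (LinearMap.mkContinuous (PreFock.reversal q) 1
    fun x => by rw [PreFock.norm_reversal, one_mul])

theorem reversal_tensor (u : List H) : reversal H q (tensor q u) = tensor q u.reverse := by
  rw [tensor, reversal, Fock.extend_incl, LinearMap.mkContinuous_apply, PreFock.reversal_word,
    tensor]

theorem reversal_reversal (x : Fock q H) : reversal H q (reversal H q x) = x := by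
  have h : reversal H q * reversal H q = 1 := ext_tensor fun u => by
    simp [reversal_tensor]
  exact congr($h x)

theorem inner_reversal (x y : Fock q H) :
    inner ℂ (reversal H q x) (reversal H q y) = inner ℂ x y := by
  have hc := (reversal H q).continuous
  refine (Fock.denseRange_incl q).induction_on₂
    (isClosed_eq ((hc.comp continuous_fst).inner (hc.comp continuous_snd))
      (continuous_fst.inner continuous_snd)) (fun x y => ?_) x y
  rw [reversal, Fock.extend_incl, Fock.extend_incl, LinearMap.mkContinuous_apply,
    LinearMap.mkContinuous_apply, LinearIsometry.inner_map_map, LinearIsometry.inner_map_map,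
    PreFock.inner_reversal]

theorem star_reversal : star (reversal H q) = reversal H q := by
  symm
  refine (ContinuousLinearMap.eq_adjoint_iff _ _).2 fun x y => ?_
  rw [← inner_reversal, reversal_reversal]

/-- Creation on the right, `f₁ ⊗ ⋯ ⊗ fₙ ↦ f₁ ⊗ ⋯ ⊗ fₙ ⊗ f`. -/
noncomputable def rightCreator (f : H) : Fock q H →L[ℂ] Fock q H :=
  reversal H q * creator q f * reversal H q

/-- Annihilation on the right, the adjoint of `rightCreator`. -/
noncomputable def rightAnnihilator (f : H) : Fock q H →L[ℂ] Fock q H :=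
  reversal H q * annihilator q f * reversal H q

theorem star_rightCreator (f : H) : star (rightCreator q f) = rightAnnihilator q f := by
  rw [rightCreator, star_mul, star_mul, star_reversal, ← mul_assoc]
  rfl

theorem rightCreator_tensor (f : H) (u : List H) :
    rightCreator q f (tensor q u) = tensor q (u ++ [f]) := by
  simp [rightCreator, reversal_tensor, creator_tensor]

variable {q}

theorem rightCreator_mul_creator (f g : H) :
    rightCreator q g * creator q f = creator q f * rightCreator q g := by
  refine ext_tensor fun u => ?_
  simp [rightCreator_tensor, creator_tensor]

theorem rightAnnihilator_mul_annihilator (f g : H) :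
    rightAnnihilator q g * annihilator q f = annihilator q f * rightAnnihilator q g := by
  have h := congrArg star (rightCreator_mul_creator (q := q) f g)
  rw [star_mul, star_mul, star_rightCreator] at h
  exact h.symm

/-- The commutator of the left annihilator of `f` and the right creator of `g` is
`⟨f, g⟩ q ^ n` on tensors of degree `n`. -/
theorem annihilator_rightCreator_tensor (f g : H) (u : List H) :
    annihilator q f (rightCreator q g (tensor q u)) =
      rightCreator q g (annihilator q f (tensor q u)) +
        ((q : ℂ) ^ u.length * inner ℂ f g) • tensor q u := by
  have hl : (u ++ [g]).length = u.length + 1 := by simp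
  rw [rightCreator_tensor, annihilator_tensor, annihilator_tensor, map_sum,
    ← Equiv.sum_comp (finCongr hl.symm), Fin.sum_univ_castSucc]
  congr 1
  · refine Finset.sum_congr rfl fun k _ => ?_
    have hk : (k : ℕ) < u.length := k.isLt
    rw [map_smul, rightCreator_tensor]
    simp [List.eraseIdx_append_of_lt_length hk]
  · simp [List.eraseIdx_append_of_length_le]

theorem rightAnnihilator_creator_tensor (f g : H) (u : List H) :
    rightAnnihilator q g (creator q f (tensor q u)) =
      creator q f (rightAnnihilator q g (tensor q u)) +
        ((q : ℂ) ^ u.length * inner ℂ g f) • tensor q u := by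
  have h := congrArg (reversal H q) (annihilator_rightCreator_tensor g f u.reverse)
  have hr : ∀ u : List H, tensor q u.reverse = reversal H q (tensor q u) :=
    fun u => (reversal_tensor q u).symm
  simpa [rightCreator, rightAnnihilator, hr, reversal_reversal] using h

/-- Left and right `q`-Gaussians commute when `⟨f, g⟩` is real: the two nonzero commutators
cancel. -/
theorem commute_gaussian {f g : H} (h : (inner ℂ g f : ℂ) = inner ℂ f g) :
    Commute (annihilator q f + creator q f) (rightAnnihilator q g + rightCreator q g) := by
  refine ext_tensor fun u => ?_
  have h1 := congr($(rightCreator_mul_creator (q := q) f g) (tensor q u))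
  have h2 := congr($(rightAnnihilator_mul_annihilator (q := q) f g) (tensor q u))
  simp only [mul_apply_eq_comp] at h1 h2
  simp only [mul_apply_eq_comp, add_apply, map_add, h1, h2,
    annihilator_rightCreator_tensor, rightAnnihilator_creator_tensor, h]
  abel

end reversal

/-! ### Norm estimates for the operators of an orthonormal family -/

section estimates

variable {q : ℝ} [hq : Fact (|q| < 1)] {H : Type} [NormedAddCommGroup H] [InnerProductSpace ℂ H]

theorem inner_creator (f : H) (x y : Fock q H) :
    inner ℂ (creator q f x) y = inner ℂ x (annihilator q f y) :=
  (ContinuousLinearMap.adjoint_inner_right _ _ _).symm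

variable {ι : Type} {e : ι → H}

/-- The quadratic form of `∑ᵢ aᵢ⁺ aᵢ`. -/
theorem inner_sum_creator_annihilator (s : Finset ι) (x : Fock q H) :
    inner ℂ (∑ i ∈ s, creator q (e i) (annihilator q (e i) x)) x =
      ((∑ i ∈ s, ‖annihilator q (e i) x‖ ^ 2 : ℝ) : ℂ) := by
  rw [sum_inner, Complex.ofReal_sum]
  refine Finset.sum_congr rfl fun i _ => ?_
  rw [inner_creator, inner_self_eq_norm_sq_to_K]
  simp

/-- `q`-analogue of the fact that the creators of an orthonormal family form a row contraction.
The norm `M` of `∑ᵢ aᵢ⁺ aᵢ` satisfies `M² ≤ M + |q| M²`, by the `q`-commutation relation. -/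
theorem norm_sum_creator_mul_annihilator_le (he : Orthonormal ℂ e) (s : Finset ι) :
    ‖∑ i ∈ s, creator q (e i) * annihilator q (e i)‖ ≤ 1 / (1 - |q|) := by
  classical
  have hq1 : 0 < 1 - |q| := sub_pos.2 hq.out
  set T := ∑ i ∈ s, creator q (e i) * annihilator q (e i) with hT
  set M := ‖T‖ with hM
  have hM0 : 0 ≤ M := norm_nonneg _
  have hTx : ∀ x, T x = ∑ i ∈ s, creator q (e i) (annihilator q (e i) x) := fun x => by
    rw [hT, sum_apply]; rfl
  have hform : ∀ x, ∑ i ∈ s, ‖annihilator q (e i) x‖ ^ 2 ≤ M * ‖x‖ ^ 2 := fun x => by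
    have h := norm_inner_le_norm (𝕜 := ℂ) (T x) x
    rw [hTx, inner_sum_creator_annihilator, ← hTx, Complex.norm_real, Real.norm_eq_abs,
      abs_of_nonneg (by positivity)] at h
    refine h.trans ?_
    have := mul_le_mul_of_nonneg_right (T.le_opNorm x) (norm_nonneg x)
    nlinarith
  have hform2 : ∀ x, ∑ i ∈ s, ∑ j ∈ s, ‖annihilator q (e j) (annihilator q (e i) x)‖ ^ 2 ≤
      M ^ 2 * ‖x‖ ^ 2 := fun x =>
    calc _ ≤ ∑ i ∈ s, M * ‖annihilator q (e i) x‖ ^ 2 := Finset.sum_le_sum fun i _ => hform _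
      _ = M * ∑ i ∈ s, ‖annihilator q (e i) x‖ ^ 2 := by rw [Finset.mul_sum]
      _ ≤ M * (M * ‖x‖ ^ 2) := mul_le_mul_of_nonneg_left (hform x) hM0
      _ = _ := by ring
  have hsq : ∀ x, ‖T x‖ ^ 2 ≤ (M + |q| * M ^ 2) * ‖x‖ ^ 2 := fun x => by
    -- `aᵢ T x = aᵢ x + q ∑ⱼ aⱼ⁺ aᵢ aⱼ x`, so the second term below is bounded by Cauchy–Schwarz
    have h1 : inner ℂ (T x) (T x) = ((∑ i ∈ s, ‖annihilator q (e i) x‖ ^ 2 : ℝ) : ℂ) +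
        q * ∑ i ∈ s, ∑ j ∈ s, inner ℂ (annihilator q (e j) (annihilator q (e i) x))
          (annihilator q (e i) (annihilator q (e j) x)) := by
      have hc : ∀ i ∈ s, annihilator q (e i) (T x) = annihilator q (e i) x +
          (q : ℂ) • ∑ j ∈ s, creator q (e j) (annihilator q (e i) (annihilator q (e j) x)) := by
        intro i hi
        rw [hTx, map_sum, Finset.smul_sum]
        have : ∀ j ∈ s, annihilator q (e i) (creator q (e j) (annihilator q (e j) x)) =
            (if i = j then annihilator q (e j) x else 0) +
              (q : ℂ) • creator q (e j) (annihilator q (e i) (annihilator q (e j) x)) := by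
          intro j _
          have h := congr($(annihilator_mul_creator (q := q) (e i) (e j)) (annihilator q (e j) x))
          simp only [mul_apply_eq_comp, add_apply, smul_apply, one_apply_eq_self,
            orthonormal_iff_ite.1 he i j] at h
          rw [h]
          congr 1
          split_ifs <;> simp
        rw [Finset.sum_congr rfl this, Finset.sum_add_distrib, Finset.sum_ite_eq, if_pos hi]
      nth_rewrite 1 [hTx]
      rw [sum_inner, Complex.ofReal_sum, Finset.mul_sum, ← Finset.sum_add_distrib]
      refine Finset.sum_congr rfl fun i hi => ?_
      rw [inner_creator, hc i hi, inner_add_right, inner_smul_right, inner_sum,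
        inner_self_eq_norm_sq_to_K]
      congr 2
      · simp
      refine Finset.sum_congr rfl fun j _ => ?_
      rw [← inner_conj_symm, inner_creator, inner_conj_symm]
    have h2 : ‖∑ i ∈ s, ∑ j ∈ s, (inner ℂ (annihilator q (e j) (annihilator q (e i) x))
          (annihilator q (e i) (annihilator q (e j) x)) : ℂ)‖ ≤ M ^ 2 * ‖x‖ ^ 2 := by
      refine le_trans ?_ (hform2 x)
      set b : ι → ι → ℝ := fun i j => ‖annihilator q (e j) (annihilator q (e i) x)‖ with hb
      calc _ ≤ ∑ i ∈ s, ∑ j ∈ s, b i j * b j i :=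
            norm_sum_le_of_le _ fun i _ => norm_sum_le_of_le _ fun j _ => norm_inner_le_norm _ _
        _ ≤ ∑ i ∈ s, ∑ j ∈ s, (b i j ^ 2 / 2 + b j i ^ 2 / 2) := by
            refine Finset.sum_le_sum fun i _ => Finset.sum_le_sum fun j _ => ?_
            nlinarith [sq_nonneg (b i j - b j i)]
        _ = ∑ i ∈ s, ∑ j ∈ s, b i j ^ 2 := by
            simp only [Finset.sum_add_distrib]
            rw [Finset.sum_comm (f := fun i j => b j i ^ 2 / 2), ← Finset.sum_add_distrib]
            refine Finset.sum_congr rfl fun i _ => ?_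
            rw [← Finset.sum_add_distrib]
            exact Finset.sum_congr rfl fun j _ => add_halves _
    have h3 : ‖T x‖ ^ 2 = ‖(inner ℂ (T x) (T x) : ℂ)‖ := by
      rw [inner_self_eq_norm_sq_to_K]; simp
    rw [h3, h1]
    refine (norm_add_le _ _).trans ?_
    rw [norm_mul, Complex.norm_real, Complex.norm_real, Real.norm_eq_abs, Real.norm_eq_abs,
      abs_of_nonneg (by positivity : 0 ≤ ∑ i ∈ s, ‖annihilator q (e i) x‖ ^ 2), add_mul, mul_assoc]
    exact add_le_add (hform x) (mul_le_mul_of_nonneg_left h2 (abs_nonneg q))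
  have hMsq : M ^ 2 ≤ M + |q| * M ^ 2 := by
    have h : M ≤ √(M + |q| * M ^ 2) := by
      refine T.opNorm_le_bound (Real.sqrt_nonneg _) fun x => ?_
      refine le_of_sq_le_sq ?_ (by positivity)
      rw [mul_pow, Real.sq_sqrt (by positivity)]
      exact hsq x
    exact (Real.le_sqrt hM0 (by positivity)).1 h
  rw [le_div_iff₀ hq1]
  rcases hM0.eq_or_lt with h0 | h0
  · rw [← h0]; simp
  · nlinarith

theorem sum_norm_annihilator_sq_le (he : Orthonormal ℂ e) (s : Finset ι) (x : Fock q H) :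
    ∑ i ∈ s, ‖annihilator q (e i) x‖ ^ 2 ≤ 1 / (1 - |q|) * ‖x‖ ^ 2 := by
  have h1 : ∑ i ∈ s, creator q (e i) (annihilator q (e i) x) =
      (∑ i ∈ s, creator q (e i) * annihilator q (e i)) x := by
    rw [sum_apply]; rfl
  have h := norm_inner_le_norm (𝕜 := ℂ) (∑ i ∈ s, creator q (e i) (annihilator q (e i) x)) x
  rw [inner_sum_creator_annihilator, Complex.norm_real, Real.norm_eq_abs,
    abs_of_nonneg (by positivity), h1] at h
  refine h.trans ?_
  have h2 := ContinuousLinearMap.le_of_opNorm_le _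
    (norm_sum_creator_mul_annihilator_le (q := q) he s) x
  have := mul_le_mul_of_nonneg_right h2 (norm_nonneg x)
  nlinarith

/-- The `ℓ²` estimate for sums whose terms start with the creators of an orthonormal family. -/
theorem norm_sum_creator_mul_le (he : Orthonormal ℂ e) (s : Finset ι) (c : ι → ℂ)
    (y : ι → Fock q H →L[ℂ] Fock q H) {K : ℝ} (hK : ∀ i, ‖y i‖ ≤ K) :
    ‖∑ i ∈ s, c i • (creator q (e i) * y i)‖ ≤
      √(1 / (1 - |q|)) * K * √(∑ i ∈ s, ‖c i‖ ^ 2) := by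
  have hq1 : 0 < 1 - |q| := sub_pos.2 hq.out
  rcases s.eq_empty_or_nonempty with rfl | ⟨i₀, -⟩
  · simp
  have hK0 : 0 ≤ K := (norm_nonneg _).trans (hK i₀)
  refine ContinuousLinearMap.opNorm_le_bound _ (by positivity) fun x => ?_
  set z := (∑ i ∈ s, c i • (creator q (e i) * y i)) x with hz
  have hz' : z = ∑ i ∈ s, creator q (e i) (c i • y i x) := by
    rw [hz, sum_apply]
    refine Finset.sum_congr rfl fun i _ => ?_
    rw [map_smul]
    rfl
  have h1 : ‖z‖ ^ 2 ≤ ∑ i ∈ s, ‖c i • y i x‖ * ‖annihilator q (e i) z‖ := by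
    have h : ‖z‖ ^ 2 = ‖(inner ℂ z z : ℂ)‖ := by rw [inner_self_eq_norm_sq_to_K]; simp
    rw [h]
    nth_rewrite 1 [hz']
    rw [sum_inner]
    refine norm_sum_le_of_le _ fun i _ => ?_
    rw [inner_creator]
    exact norm_inner_le_norm _ _
  have h2 : ∑ i ∈ s, ‖c i • y i x‖ ^ 2 ≤ (K * ‖x‖) ^ 2 * ∑ i ∈ s, ‖c i‖ ^ 2 := by
    rw [Finset.mul_sum]
    refine Finset.sum_le_sum fun i _ => ?_
    rw [norm_smul, mul_pow, mul_comm]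
    gcongr
    exact (y i).le_of_opNorm_le (hK i) x
  have h3 := Real.sum_mul_le_sqrt_mul_sqrt s (fun i => ‖c i • y i x‖)
    fun i => ‖annihilator q (e i) z‖
  have h4 : ‖z‖ ^ 2 ≤ (K * ‖x‖ * √(∑ i ∈ s, ‖c i‖ ^ 2)) * (√(1 / (1 - |q|)) * ‖z‖) := by
    refine (h1.trans h3).trans (mul_le_mul ?_ ?_ (Real.sqrt_nonneg _) (by positivity))
    · refine (Real.sqrt_le_sqrt h2).trans_eq ?_
      rw [Real.sqrt_mul (by positivity), Real.sqrt_sq (by positivity)]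
    · refine (Real.sqrt_le_sqrt (sum_norm_annihilator_sq_le he s z)).trans_eq ?_
      rw [Real.sqrt_mul (by positivity), Real.sqrt_sq (by positivity)]
  rcases (norm_nonneg z).eq_or_lt with h0 | h0
  · rw [← h0]; positivity
  · refine le_of_mul_le_mul_right ?_ h0
    linarith

theorem norm_sum_mul_annihilator_le (he : Orthonormal ℂ e) (s : Finset ι) (c : ι → ℂ)
    (y : ι → Fock q H →L[ℂ] Fock q H) {K : ℝ} (hK : ∀ i, ‖y i‖ ≤ K) :
    ‖∑ i ∈ s, c i • (y i * annihilator q (e i))‖ ≤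
      √(1 / (1 - |q|)) * K * √(∑ i ∈ s, ‖c i‖ ^ 2) := by
  have h := norm_sum_creator_mul_le (q := q) he s (fun i => conj (c i)) (fun i => star (y i))
    fun i => (norm_star (y i)).trans_le (hK i)
  rw [← norm_star, star_sum] at h
  simpa [annihilator] using h

/-- A bounded functional that satisfies an `ℓ²` estimate along a sequence tends to zero along it. -/
theorem tendsto_zero_of_norm_sum_le {E : Type} [NormedAddCommGroup E] [NormedSpace ℂ E]
    (φ : E →L[ℂ] ℂ) (x : ℕ → E) {K : ℝ}
    (h : ∀ (s : Finset ℕ) (c : ℕ → ℂ), ‖∑ n ∈ s, c n • x n‖ ≤ K * √(∑ n ∈ s, ‖c n‖ ^ 2)) :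
    Filter.Tendsto (fun n => φ (x n)) Filter.atTop (nhds 0) := by
  have hb : ∀ s : Finset ℕ, ∑ n ∈ s, ‖φ (x n)‖ ^ 2 ≤ (‖φ‖ * K) ^ 2 := by
    intro s
    set S := ∑ n ∈ s, ‖φ (x n)‖ ^ 2 with hS
    have hS0 : 0 ≤ S := by positivity
    -- test the estimate on the coefficients `conj (φ (x n))`
    have h1 : φ (∑ n ∈ s, conj (φ (x n)) • x n) = (S : ℂ) := by
      rw [map_sum, hS, Complex.ofReal_sum]
      refine Finset.sum_congr rfl fun n _ => ?_
      rw [map_smul, smul_eq_mul, Complex.conj_mul', Complex.ofReal_pow]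
    have h2 := (φ.le_opNorm (∑ n ∈ s, conj (φ (x n)) • x n)).trans
      (mul_le_mul_of_nonneg_left (h s fun n => conj (φ (x n))) (norm_nonneg φ))
    simp only [h1, Complex.norm_real, Real.norm_eq_abs, abs_of_nonneg hS0, RCLike.norm_conj] at h2
    rw [← hS, ← mul_assoc] at h2
    have h3 : √S * √S = S := Real.mul_self_sqrt hS0
    rcases (Real.sqrt_nonneg S).eq_or_lt with h0 | h0
    · rw [← h3, ← h0, zero_mul]; positivity
    · have h4 : √S ≤ ‖φ‖ * K := le_of_mul_le_mul_right (h3.trans_le h2) h0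
      rw [← h3, ← sq]
      gcongr
  have hs : Summable fun n => ‖φ (x n)‖ ^ 2 := summable_of_sum_le (fun _ => by positivity) hb
  have ht := hs.tendsto_atTop_zero.sqrt
  simp only [Real.sqrt_sq (norm_nonneg _), Real.sqrt_zero] at ht
  exact tendsto_zero_iff_norm_tendsto_zero.2 ht

end estimates

/-! ### Cyclicity of the vacuum -/

section cyclic

theorem orthonormal_stdVec : Orthonormal ℂ stdVec := by
  rw [orthonormal_iff_ite]
  intro i j
  rw [stdVec, stdVec, lp.inner_single_left, lp.single_apply]
  by_cases h : i = j
  · subst h; simp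
  · simp [h]

theorem inner_stdVec_comm (i j : ℤ) :
    (inner ℂ (stdVec i) (stdVec j) : ℂ) = inner ℂ (stdVec j) (stdVec i) := by
  rw [orthonormal_iff_ite.1 orthonormal_stdVec, orthonormal_iff_ite.1 orthonormal_stdVec]
  simp only [eq_comm]

theorem eq_top_of_stdVec_mem {K : Submodule ℂ EllTwoZ} (hK : IsClosed (K : Set EllTwoZ))
    (h : ∀ i, stdVec i ∈ K) : K = ⊤ := by
  refine eq_top_iff.2 fun f _ => ?_
  refine hK.mem_of_tendsto (lp.hasSum_single (by simp) f) (.of_forall fun s => ?_)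
  refine Submodule.sum_mem _ fun i _ => ?_
  have : lp.single 2 i (f i) = f i • stdVec i := by
    rw [stdVec, ← lp.single_smul, smul_eq_mul, mul_one]
  rw [this]
  exact Submodule.smul_mem _ _ (h i)

variable {q : ℝ} [hq : Fact (|q| < 1)]

/-- Replacing the letters of a word one at a time by limits of combinations of basis vectors reaches
all words: the induction hypothesis is applied to the preimages of `K` under the creators of the
basis vectors. -/
theorem tensor_mem_of_stdVec_mem (w : List EllTwoZ) : ∀ {K : Submodule ℂ (Fock q EllTwoZ)},
    IsClosed (K : Set (Fock q EllTwoZ)) → (∀ u : List ℤ, tensor q (u.map stdVec) ∈ K) →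
      tensor q w ∈ K := by
  induction w with
  | nil => exact fun _ h => h []
  | cons f w ih =>
    intro K hK h
    have h1 : K.comap (creatorMap (tensor q w)).toLinearMap = ⊤ := by
      refine eq_top_of_stdVec_mem (hK.preimage (creatorMap (tensor q w)).continuous) fun i => ?_
      refine ih (K := K.comap (creator q (stdVec i)).toLinearMap)
        (hK.preimage (creator q (stdVec i)).continuous) fun u => ?_
      change creator q (stdVec i) (tensor q (u.map stdVec)) ∈ K
      rw [creator_tensor]
      exact h (i :: u)
    have h2 : f ∈ K.comap (creatorMap (tensor q w)).toLinearMap := h1 ▸ Submodule.mem_top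
    have h3 : creator q f (tensor q w) ∈ K := h2
    rwa [creator_tensor] at h3

theorem eq_top_of_tensor_mem {K : Submodule ℂ (Fock q EllTwoZ)}
    (hK : IsClosed (K : Set (Fock q EllTwoZ))) (h : ∀ u : List ℤ, tensor q (u.map stdVec) ∈ K) :
    K = ⊤ := by
  refine eq_top_iff.2 fun x _ => ?_
  refine (Fock.denseRange_incl q).induction_on x hK fun x => ?_
  induction x using PreFock.induction with
  | h0 => rw [map_zero]; exact K.zero_mem
  | hadd x y hx hy => rw [map_add]; exact K.add_mem hx hy
  | hword c u => rw [map_smul]; exact K.smul_mem _ (tensor_mem_of_stdVec_mem u hK h)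

/-- A subspace invariant under the `q`-Gaussians contains the words in the basis vectors if it
contains the vacuum: the Gaussian of `eᵢ` maps a word `w` to `eᵢ ⊗ w` up to shorter words. -/
theorem tensor_mem_of_invariant {K : Submodule ℂ (Fock q EllTwoZ)} (h0 : vacuum q EllTwoZ ∈ K)
    (h : ∀ i, ∀ x ∈ K, (a q i + aPlus q i) x ∈ K) (n : ℕ) :
    ∀ u : List ℤ, u.length = n → tensor q (u.map stdVec) ∈ K := by
  induction n using Nat.strong_induction_on with
  | _ n ih =>
    rintro (_ | ⟨i, u⟩) hu
    · exact h0
    · simp only [List.length_cons] at hu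
      have h1 : tensor q ((i :: u).map stdVec) = (a q i + aPlus q i) (tensor q (u.map stdVec)) -
          annihilator q (stdVec i) (tensor q (u.map stdVec)) := by
        rw [add_apply, a, aPlus, add_sub_cancel_left, creator_tensor, List.map_cons]
      rw [h1]
      refine K.sub_mem (h i _ (ih u.length (by omega) u rfl)) ?_
      rw [annihilator_tensor]
      refine Submodule.sum_mem _ fun k _ => K.smul_mem _ ?_
      have hk : (k : ℕ) < u.length := by simpa using k.isLt
      rw [List.eraseIdx_map]
      exact ih (u.length - 1) (by omega) _ (List.length_eraseIdx_of_lt hk)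

end cyclic

/-! ### The vacuum state is a faithful trace -/

section trace

variable (q : ℝ) [hq : Fact (|q| < 1)]

/-- The right `q`-Gaussians, which lie in the commutant of `algG`. -/
noncomputable def rightGaussian (i : ℤ) : Fock q EllTwoZ →L[ℂ] Fock q EllTwoZ :=
  rightAnnihilator q (stdVec i) + rightCreator q (stdVec i)

theorem star_rightGaussian (i : ℤ) : star (rightGaussian q i) = rightGaussian q i := by
  rw [rightGaussian, ← star_rightCreator, star_add, star_star, add_comm]

theorem star_gaussian (i : ℤ) : star (a q i + aPlus q i) = a q i + aPlus q i := by
  rw [← star_aPlus, star_add, star_star, add_comm]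

theorem gaussian_mem (i : ℤ) : a q i + aPlus q i ∈ algG q := subset_generatedCStar _ ⟨i, rfl⟩

theorem rightGaussian_vacuum (i : ℤ) :
    rightGaussian q i (vacuum q EllTwoZ) = (a q i + aPlus q i) (vacuum q EllTwoZ) := by
  have h : reversal EllTwoZ q (vacuum q EllTwoZ) = vacuum q EllTwoZ := reversal_tensor q []
  have h2 : rightAnnihilator q (stdVec i) (vacuum q EllTwoZ) = 0 := by
    simp [rightAnnihilator, h, annihilator_vacuum]
  rw [rightGaussian, a, aPlus, add_apply, add_apply, h2, annihilator_vacuum, vacuum,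
    rightCreator_tensor, creator_tensor, List.nil_append]

theorem commute_rightGaussian (i : ℤ) {x : Fock q EllTwoZ →L[ℂ] Fock q EllTwoZ}
    (hx : x ∈ algG q) : Commute (rightGaussian q i) x := by
  have h : algG q ≤ StarSubalgebra.centralizer ℂ {rightGaussian q i} := by
    refine generatedCStar_le (Set.isClosed_centralizer _) ?_
    rintro _ ⟨j, rfl⟩
    refine (StarSubalgebra.mem_centralizer_iff ℂ).2 ?_
    rintro _ rfl
    rw [star_rightGaussian, and_self]
    exact (commute_gaussian (inner_stdVec_comm i j)).symm
  exact ((StarSubalgebra.mem_centralizer_iff ℂ).1 (h hx) _ rfl).1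

/-- The vacuum expectation as a functional on all bounded operators. -/
noncomputable def vacuumState : (Fock q EllTwoZ →L[ℂ] Fock q EllTwoZ) →L[ℂ] ℂ :=
  (innerSL ℂ (vacuum q EllTwoZ)) ∘L
    (ContinuousLinearMap.apply ℂ (Fock q EllTwoZ) (vacuum q EllTwoZ))

theorem vacuumState_apply (x : Fock q EllTwoZ →L[ℂ] Fock q EllTwoZ) :
    vacuumState q x = inner ℂ (vacuum q EllTwoZ) (x (vacuum q EllTwoZ)) := rfl

theorem vacuumState_star (x : Fock q EllTwoZ →L[ℂ] Fock q EllTwoZ) :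
    vacuumState q (star x) = conj (vacuumState q x) := by
  rw [vacuumState_apply, vacuumState_apply, inner_conj_symm]
  exact ContinuousLinearMap.adjoint_inner_right _ _ _

/-- A left `q`-Gaussian acts on the vacuum like the corresponding right one, and can be moved to the
other side of an operator of `algG` in this form. -/
theorem vacuumState_gaussian_mul (i : ℤ) {y : Fock q EllTwoZ →L[ℂ] Fock q EllTwoZ}
    (hy : y ∈ algG q) :
    vacuumState q ((a q i + aPlus q i) * y) = vacuumState q (y * (a q i + aPlus q i)) := by
  have h1 := congr($((commute_rightGaussian q i hy).eq) (vacuum q EllTwoZ))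
  simp only [mul_apply_eq_comp] at h1
  rw [vacuumState_apply, vacuumState_apply, mul_apply_eq_comp, mul_apply_eq_comp,
    ← rightGaussian_vacuum, ← h1]
  have hs : ∀ (T : Fock q EllTwoZ →L[ℂ] Fock q EllTwoZ) (z w : Fock q EllTwoZ), star T = T →
      (inner ℂ z (T w) : ℂ) = inner ℂ (T z) w := fun T z w hT => by
    nth_rewrite 1 [← hT]
    exact ContinuousLinearMap.adjoint_inner_right _ _ _
  rw [hs _ _ _ (star_gaussian q i), hs _ _ _ (star_rightGaussian q i), rightGaussian_vacuum]

/-- The operators of `algG` that can be cyclically moved past all others form a closed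
`*`-subalgebra, which contains the `q`-Gaussians. -/
theorem vacuumState_mul_comm {x y : Fock q EllTwoZ →L[ℂ] Fock q EllTwoZ}
    (hx : x ∈ algG q) (hy : y ∈ algG q) : vacuumState q (x * y) = vacuumState q (y * x) := by
  let S : StarSubalgebra ℂ (Fock q EllTwoZ →L[ℂ] Fock q EllTwoZ) :=
    { carrier := {x | x ∈ algG q ∧ ∀ y ∈ algG q, vacuumState q (x * y) = vacuumState q (y * x)}
      mul_mem' := fun {x z} hx hz => ⟨mul_mem hx.1 hz.1, fun y hy => by
        rw [mul_assoc, hx.2 _ (mul_mem hz.1 hy), mul_assoc, hz.2 _ (mul_mem hy hx.1), mul_assoc]⟩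
      add_mem' := fun {x z} hx hz => ⟨add_mem hx.1 hz.1, fun y hy => by
        rw [add_mul, mul_add, map_add, map_add, hx.2 y hy, hz.2 y hy]⟩
      algebraMap_mem' := fun c => ⟨algebraMap_mem _ c, fun y _ => by rw [Algebra.commutes]⟩
      star_mem' := fun {x} hx => ⟨star_mem hx.1, fun y hy => by
        rw [← star_star y, ← star_mul, ← star_mul, vacuumState_star, vacuumState_star,
          hx.2 _ (star_mem hy)]⟩ }
  have hS : IsClosed (S : Set (Fock q EllTwoZ →L[ℂ] Fock q EllTwoZ)) := by
    have e : (S : Set (Fock q EllTwoZ →L[ℂ] Fock q EllTwoZ)) = (algG q : Set _) ∩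
        ⋂ y ∈ algG q, {x | vacuumState q (x * y) = vacuumState q (y * x)} := by
      ext x
      simp only [Set.mem_inter_iff, Set.mem_iInter]
      rfl
    rw [e]
    refine (StarSubalgebra.isClosed_topologicalClosure _).inter <|
      isClosed_iInter fun y => isClosed_iInter fun _ => isClosed_eq ?_ ?_
    · exact (vacuumState q).continuous.comp (continuous_id.mul continuous_const)
    · exact (vacuumState q).continuous.comp (continuous_const.mul continuous_id)
  refine (generatedCStar_le hS ?_ hx).2 y hy
  rintro _ ⟨i, rfl⟩
  exact ⟨gaussian_mem q i, fun y hy => vacuumState_gaussian_mul q i hy⟩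

theorem vacuumState_star_mul_self (x : Fock q EllTwoZ →L[ℂ] Fock q EllTwoZ) :
    vacuumState q (star x * x) = ((‖x (vacuum q EllTwoZ)‖ ^ 2 : ℝ) : ℂ) := by
  have h : vacuumState q (star x * x) =
      inner ℂ (x (vacuum q EllTwoZ)) (x (vacuum q EllTwoZ)) :=
    ContinuousLinearMap.adjoint_inner_right x _ _
  rw [h, inner_self_eq_norm_sq_to_K]
  simp

/-- The vacuum is separating for `algG`: by traciality the kernel of an operator of `algG` that
kills the vacuum `Ω` contains `algG Ω`, which is dense. -/
theorem eq_zero_of_apply_vacuum {x : Fock q EllTwoZ →L[ℂ] Fock q EllTwoZ} (hx : x ∈ algG q)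
    (h : x (vacuum q EllTwoZ) = 0) : x = 0 := by
  have hxy : ∀ y ∈ algG q, x (y (vacuum q EllTwoZ)) = 0 := fun y hy => by
    have h1 : vacuumState q (star (x * y) * (x * y)) = 0 := by
      rw [star_mul, mul_assoc, vacuumState_mul_comm q (star_mem hy)
        (mul_mem (star_mem hx) (mul_mem hx hy)), mul_assoc, mul_assoc, vacuumState_apply]
      refine (ContinuousLinearMap.adjoint_inner_right x _ _).trans ?_
      rw [h, inner_zero_left]
    rw [vacuumState_star_mul_self] at h1
    simpa using h1
  let K : Submodule ℂ (Fock q EllTwoZ) := (algG q).toSubalgebra.toSubmodule.map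
    (ContinuousLinearMap.apply ℂ (Fock q EllTwoZ) (vacuum q EllTwoZ)).toLinearMap
  have hK : ∀ u : List ℤ, tensor q (u.map stdVec) ∈ K := fun u => by
    refine tensor_mem_of_invariant (K := K) ⟨1, one_mem (algG q), rfl⟩ ?_ u.length u rfl
    rintro i _ ⟨y, hy, rfl⟩
    exact ⟨(a q i + aPlus q i) * y, mul_mem (S := StarSubalgebra ℂ _) (gaussian_mem q i) hy, rfl⟩
  have hker : x.toLinearMap.ker = ⊤ := by
    refine eq_top_of_tensor_mem (isClosed_singleton.preimage x.continuous) fun u => ?_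
    obtain ⟨y, hy, hyu⟩ := hK u
    rw [← hyu]
    exact hxy y hy
  ext z
  exact LinearMap.congr_fun (LinearMap.ker_eq_top.1 hker) z

end trace

/-! ### Mixing of the shift -/

section mixing

variable (q : ℝ) [hq : Fact (|q| < 1)]

theorem norm_conjAut (x : Fock q EllTwoZ →L[ℂ] Fock q EllTwoZ) :
    ‖conjAut q rightShift x‖ = ‖x‖ := by
  rw [conjAut, Unitary.conjStarAlgAut_apply, ← Unitary.coe_star, CStarRing.norm_mul_coe_unitary,
    CStarRing.norm_coe_unitary_mul]

theorem norm_conjAut_iterate (n : ℕ) (x : Fock q EllTwoZ →L[ℂ] Fock q EllTwoZ) :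
    ‖(conjAut q rightShift)^[n] x‖ = ‖x‖ := by
  induction n with
  | zero => rfl
  | succ n ih => rw [Function.iterate_succ_apply', norm_conjAut, ih]

theorem conjAut_iterate_a (n : ℕ) (i : ℤ) :
    (conjAut q rightShift)^[n] (a q i) = a q (i + n) := by
  induction n with
  | zero => simp
  | succ n ih => rw [Function.iterate_succ_apply', ih, conjAut_rightShift_a]; push_cast; ring_nf

theorem conjAut_iterate_aPlus (n : ℕ) (i : ℤ) :
    (conjAut q rightShift)^[n] (aPlus q i) = aPlus q (i + n) := by
  induction n with
  | zero => simp
  | succ n ih => rw [Function.iterate_succ_apply', ih, conjAut_rightShift_aPlus]; push_cast; ring_nf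

/-- The operators `x` such that `φ(αⁿ(x)) → φ(1) ω(x)` for all bounded functionals `φ` on the
bounded operators, where `α` is conjugation by the second quantized shift and `ω` is the vacuum state. -/
noncomputable def mixingSubmodule : Submodule ℂ (Fock q EllTwoZ →L[ℂ] Fock q EllTwoZ) where
  carrier := {x | ∀ φ : (Fock q EllTwoZ →L[ℂ] Fock q EllTwoZ) →L[ℂ] ℂ,
    Filter.Tendsto (fun n : ℕ => φ ((conjAut q rightShift)^[n] x)) Filter.atTop
      (nhds (φ 1 * vacuumState q x))}
  zero_mem' φ := by simp [iterate_map_zero]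
  add_mem' hx hy φ := by
    simp only [iterate_map_add, map_add, mul_add]
    exact (hx φ).add (hy φ)
  smul_mem' c x hx φ := by
    have h : ∀ n : ℕ, (conjAut q rightShift)^[n] (c • x) = c • (conjAut q rightShift)^[n] x := by
      intro n
      induction n with
      | zero => rfl
      | succ n ih => rw [Function.iterate_succ_apply', ih, map_smul, Function.iterate_succ_apply']
    simp only [h, map_smul, smul_eq_mul, mul_left_comm _ c]
    exact (hx φ).const_mul c

theorem isClosed_mixingSubmodule :
    IsClosed (mixingSubmodule q : Set (Fock q EllTwoZ →L[ℂ] Fock q EllTwoZ)) := by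
  have e : (mixingSubmodule q : Set (Fock q EllTwoZ →L[ℂ] Fock q EllTwoZ)) =
      ⋂ φ : (Fock q EllTwoZ →L[ℂ] Fock q EllTwoZ) →L[ℂ] ℂ,
        {x | Filter.Tendsto (fun n : ℕ => φ ((conjAut q rightShift)^[n] x)) Filter.atTop
          (nhds (φ 1 * vacuumState q x))} := by
    ext x
    rw [Set.mem_iInter]
    rfl
  rw [e]
  refine isClosed_iInter fun φ => Equicontinuous.isClosed_setOfPred_tendsto ?_
    (continuous_const.mul (vacuumState q).continuous)
  refine (LipschitzWith.uniformEquicontinuous _ ‖φ‖₊ fun n => ?_).equicontinuous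
  refine LipschitzWith.of_dist_le_mul fun x y => ?_
  rw [dist_eq_norm, dist_eq_norm, ← map_sub, ← iterate_map_sub, coe_nnnorm]
  exact (φ.le_opNorm _).trans_eq (by rw [norm_conjAut_iterate])

theorem orthonormal_stdVec_add (i : ℤ) : Orthonormal ℂ fun n : ℕ => stdVec (i + n) :=
  orthonormal_stdVec.comp _ fun m n h => by simpa using h

theorem aPlus_mul_mem_mixingSubmodule (i : ℤ) (y : Fock q EllTwoZ →L[ℂ] Fock q EllTwoZ) :
    aPlus q i * y ∈ mixingSubmodule q := by
  intro φ
  have h0 : vacuumState q (aPlus q i * y) = 0 := by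
    rw [← star_star (aPlus q i * y), vacuumState_star, star_mul, star_aPlus, vacuumState_apply,
      mul_apply_eq_comp, a, annihilator_vacuum, map_zero, inner_zero_right, map_zero]
  rw [h0, mul_zero]
  refine tendsto_zero_of_norm_sum_le φ _ (K := √(1 / (1 - |q|)) * ‖y‖) fun s c => ?_
  simp only [iterate_map_mul, conjAut_iterate_aPlus]
  exact norm_sum_creator_mul_le (orthonormal_stdVec_add i) s c _
    fun n => (norm_conjAut_iterate q n y).le

theorem mul_a_mem_mixingSubmodule (i : ℤ) (y : Fock q EllTwoZ →L[ℂ] Fock q EllTwoZ) :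
    y * a q i ∈ mixingSubmodule q := by
  intro φ
  have h0 : vacuumState q (y * a q i) = 0 := by
    rw [vacuumState_apply, mul_apply_eq_comp, a, annihilator_vacuum, map_zero, inner_zero_right]
  rw [h0, mul_zero]
  refine tendsto_zero_of_norm_sum_le φ _ (K := √(1 / (1 - |q|)) * ‖y‖) fun s c => ?_
  simp only [iterate_map_mul, conjAut_iterate_a]
  exact norm_sum_mul_annihilator_le (orthonormal_stdVec_add i) s c _
    fun n => (norm_conjAut_iterate q n y).le

theorem one_mem_mixingSubmodule :
    (1 : Fock q EllTwoZ →L[ℂ] Fock q EllTwoZ) ∈ mixingSubmodule q := by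
  intro φ
  have h0 : vacuumState q 1 = 1 := by
    have h := vacuumState_star_mul_self q 1
    rwa [star_one, one_mul, one_apply_eq_self, norm_vacuum, one_pow, Complex.ofReal_one] at h
  simp [iterate_map_one, h0]

/-- The span of the normally ordered words, in which the creators stand to the left of the
annihilators. -/
noncomputable def normallyOrdered : Submodule ℂ (Fock q EllTwoZ →L[ℂ] Fock q EllTwoZ) :=
  Submodule.span ℂ (Set.image2 (fun c b => c * b) (Submonoid.closure (Set.range (aPlus q)))
    (Submonoid.closure (Set.range (a q))))

theorem normallyOrdered_le_mixingSubmodule : normallyOrdered q ≤ mixingSubmodule q := by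
  refine Submodule.span_le.2 ?_
  rintro _ ⟨c, hc, b, hb, rfl⟩
  beta_reduce
  induction hc using Submonoid.closure_induction_left with
  | one =>
    rw [one_mul]
    induction hb using Submonoid.closure_induction_right with
    | one => exact one_mem_mixingSubmodule q
    | mul_right x _ y hy =>
      obtain ⟨i, rfl⟩ := hy
      exact mul_a_mem_mixingSubmodule q i x
  | mul_left x hx y _ =>
    obtain ⟨i, rfl⟩ := hx
    rw [mul_assoc]
    exact aPlus_mul_mem_mixingSubmodule q i _

theorem aPlus_mul_mem_normallyOrdered (i : ℤ) {x : Fock q EllTwoZ →L[ℂ] Fock q EllTwoZ}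
    (hx : x ∈ normallyOrdered q) : aPlus q i * x ∈ normallyOrdered q := by
  induction hx using Submodule.span_induction with
  | mem x hx =>
    obtain ⟨c, hc, b, hb, rfl⟩ := hx
    exact Submodule.subset_span
      ⟨aPlus q i * c, mul_mem (Submonoid.subset_closure ⟨i, rfl⟩) hc, b, hb, mul_assoc _ _ _⟩
  | zero => rw [mul_zero]; exact Submodule.zero_mem _
  | add x y _ _ hx hy => rw [mul_add]; exact Submodule.add_mem _ hx hy
  | smul c x _ hx => rw [mul_smul_comm]; exact Submodule.smul_mem _ _ hx

/-- Moving `aᵢ` through the creators of a normally ordered word by the `q`-commutation relation. -/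
theorem a_mul_mem_normallyOrdered (i : ℤ) {x : Fock q EllTwoZ →L[ℂ] Fock q EllTwoZ}
    (hx : x ∈ normallyOrdered q) : a q i * x ∈ normallyOrdered q := by
  induction hx using Submodule.span_induction with
  | mem x hx =>
    obtain ⟨c, hc, b, hb, rfl⟩ := hx
    beta_reduce
    induction hc using Submonoid.closure_induction_left with
    | one =>
      refine Submodule.subset_span
        ⟨1, one_mem _, a q i * b, mul_mem (Submonoid.subset_closure ⟨i, rfl⟩) hb, ?_⟩
      simp only [one_mul]
    | mul_left x hx y hy ih =>
      obtain ⟨j, rfl⟩ := hx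
      have h : a q i * (aPlus q j * y * b) = (inner ℂ (stdVec i) (stdVec j) : ℂ) • (y * b) +
          (q : ℂ) • (aPlus q j * (a q i * (y * b))) := by
        have h1 : a q i * aPlus q j = (inner ℂ (stdVec i) (stdVec j) : ℂ) • 1 +
            (q : ℂ) • (aPlus q j * a q i) := annihilator_mul_creator _ _
        rw [mul_assoc, ← mul_assoc, h1, add_mul, smul_mul_assoc, smul_mul_assoc, one_mul,
          mul_assoc (aPlus q j)]
      rw [h]
      exact Submodule.add_mem _
        (Submodule.smul_mem _ _ (Submodule.subset_span ⟨y, hy, b, hb, rfl⟩))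
        (Submodule.smul_mem _ _ (aPlus_mul_mem_normallyOrdered q j ih))
  | zero => rw [mul_zero]; exact Submodule.zero_mem _
  | add x y _ _ hx hy => rw [mul_add]; exact Submodule.add_mem _ hx hy
  | smul c x _ hx => rw [mul_smul_comm]; exact Submodule.smul_mem _ _ hx

theorem adjoin_gaussian_subset_normallyOrdered {x : Fock q EllTwoZ →L[ℂ] Fock q EllTwoZ}
    (hx : x ∈ StarAlgebra.adjoin ℂ (Set.range fun i => a q i + aPlus q i)) :
    x ∈ normallyOrdered q := by
  suffices h : ∀ y ∈ normallyOrdered q, x * y ∈ normallyOrdered q by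
    simpa using h 1 (Submodule.subset_span ⟨1, one_mem _, 1, one_mem _, mul_one 1⟩)
  rw [← StarSubalgebra.mem_toSubalgebra, StarAlgebra.adjoin_toSubalgebra] at hx
  induction hx using Algebra.adjoin_induction with
  | mem x hx =>
    have h1 : ∃ i, a q i + aPlus q i = x := by
      rcases hx with h | ⟨i, hi⟩
      · exact h
      · exact ⟨i, by rw [← star_gaussian, ← star_star x]; exact congrArg star hi⟩
    obtain ⟨i, rfl⟩ := h1
    intro y hy
    rw [add_mul]
    exact Submodule.add_mem _ (a_mul_mem_normallyOrdered q i hy)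
      (aPlus_mul_mem_normallyOrdered q i hy)
  | algebraMap c =>
    intro y hy
    rw [← Algebra.smul_def]
    exact Submodule.smul_mem _ _ hy
  | add x z _ _ hx hz =>
    intro y hy
    rw [add_mul]
    exact Submodule.add_mem _ (hx y hy) (hz y hy)
  | mul x z _ _ hx hz =>
    intro y hy
    rw [mul_assoc]
    exact hx _ (hz y hy)

theorem algG_subset_mixingSubmodule {x : Fock q EllTwoZ →L[ℂ] Fock q EllTwoZ}
    (hx : x ∈ algG q) : x ∈ mixingSubmodule q :=
  closure_minimal (fun _ hx => normallyOrdered_le_mixingSubmodule q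
    (adjoin_gaussian_subset_normallyOrdered q hx)) (isClosed_mixingSubmodule q) hx

end mixing

/-! ### The dynamical system on the algebra of the Gaussians -/

section conclusion

variable (q : ℝ) [hq : Fact (|q| < 1)]

theorem coe_shiftG_iterate (n : ℕ) (x : algG q) :
    (((shiftG q)^[n] x : algG q) : Fock q EllTwoZ →L[ℂ] Fock q EllTwoZ) =
      (conjAut q rightShift)^[n] x := by
  induction n with
  | zero => rfl
  | succ n ih =>
    rw [Function.iterate_succ_apply', Function.iterate_succ_apply', ← ih, shiftG, coe_restrictAut]

/-- Functionals on `algG` extend to all bounded operators by the Hahn–Banach theorem, which gives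
the mixing property with the vacuum state as the limit. -/
theorem tendsto_shiftG_iterate (φ : algG q →L[ℂ] ℂ) (x : algG q) :
    Filter.Tendsto (fun n : ℕ => φ ((shiftG q)^[n] x)) Filter.atTop
      (nhds (φ 1 * vacuumG q x)) := by
  obtain ⟨ψ, hψ, -⟩ := exists_extension_norm_eq (𝕜 := ℂ) (algG q).toSubalgebra.toSubmodule φ
  have h := algG_subset_mixingSubmodule q x.2 ψ
  have h1 : ψ 1 = φ 1 := hψ ⟨1, one_mem (algG q)⟩
  rw [h1] at h
  refine h.congr fun n => ?_
  rw [← coe_shiftG_iterate]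
  exact hψ _

theorem isState_vacuumG : IsState (vacuumG q) := by
  refine ⟨?_, fun x => ?_⟩
  · have h : vacuumG q 1 = inner ℂ (vacuum q EllTwoZ) (vacuum q EllTwoZ) := rfl
    rw [h, inner_self_eq_norm_sq_to_K, norm_vacuum]
    simp
  · have h : vacuumG q (star x * x) = vacuumState q 
        (star (x : Fock q EllTwoZ →L[ℂ] Fock q EllTwoZ) * x) := rfl
    rw [h, vacuumState_star_mul_self]
    exact Complex.zero_le_real.2 (by positivity)

theorem isInvariant_vacuumG : IsInvariant (shiftG q) (vacuumG q) := by
  intro x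
  -- `ω (αⁿ (α x))` is a tail of `ω (αⁿ x)`, and the two sequences tend to `ω (α x)` and `ω x`
  have h1 := tendsto_shiftG_iterate q (vacuumG q) x
  have h2 := tendsto_shiftG_iterate q (vacuumG q) (shiftG q x)
  have h3 := (Filter.tendsto_add_atTop_iff_nat 1).2 h1
  rw [(isState_vacuumG q).1, one_mul] at h2 h3
  exact tendsto_nhds_unique h2 h3

theorem eq_vacuumG_of_isInvariant {φ : algG q →L[ℂ] ℂ} (hφ : IsState φ)
    (h : IsInvariant (shiftG q) φ) : φ = vacuumG q := by
  ext x
  have hn : ∀ n : ℕ, φ ((shiftG q)^[n] x) = φ x := fun n => by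
    induction n with
    | zero => rfl
    | succ n ih => rw [Function.iterate_succ_apply', h, ih]
  have h1 := tendsto_shiftG_iterate q φ x
  simp only [hn, hφ.1, one_mul] at h1
  exact tendsto_nhds_unique tendsto_const_nhds h1

end conclusion

end QGaussian

theorem corollary3p4 (q : ℝ) [Fact (|q| < 1)] :
    QGaussian.UniquelyMixing (QGaussian.shiftG q) ∧
    QGaussian.IsState (QGaussian.vacuumG q) ∧
    (∀ φ : QGaussian.algG q →L[ℂ] ℂ, QGaussian.IsState φ →
      (QGaussian.IsInvariant (QGaussian.shiftG q) φ ↔ φ = QGaussian.vacuumG q)) ∧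
    QGaussian.IsTracial (QGaussian.vacuumG q) ∧
    QGaussian.IsFaithful (QGaussian.vacuumG q) := by
  refine ⟨⟨QGaussian.vacuumG q, QGaussian.isState_vacuumG q, QGaussian.tendsto_shiftG_iterate q⟩,
    QGaussian.isState_vacuumG q, fun φ hφ => ⟨QGaussian.eq_vacuumG_of_isInvariant q hφ, ?_⟩,
    fun x y => QGaussian.vacuumState_mul_comm q x.2 y.2, fun x hx => ?_⟩
  · rintro rfl
    exact QGaussian.isInvariant_vacuumG q
  · have h : QGaussian.vacuumState q
        (star (x : QGaussian.Fock q QGaussian.EllTwoZ →L[ℂ] QGaussian.Fock q QGaussian.EllTwoZ) *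
          x) = 0 := hx
    rw [QGaussian.vacuumState_star_mul_self] at h
    exact Subtype.ext (QGaussian.eq_zero_of_apply_vacuum q x.2 (by simpa using h))
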